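/- Let $\pi_{\mathrm b}\colon\mathbb R\to\mathbb R$ be a (measurable) probability density with at most polynomial decay, i.e. there is a polynomial $p_{\mathrm b}\colon\mathbb R\to(0,\infty)$ with $1\le p_{\mathrm b}(z)\,\pi_{\mathrm b}(z)$ for all $z\in\mathbb R$. There exists $k\in\mathbb N$, depending only on $\pi_{\mathrm b}$, and for all $\nu>1$, $M>0$ and $C>0$ with $C^2>\frac1{8\pi^2}$ there exists a constant $C_{\mathrm{app}}>0$, depending only on $\nu,\pi_{\mathrm b},C,M$, such that the following holds for all integers $d,N\ge1$. On a probability space $(\Omega,\mathcal F,\mathbb P)$ let $A_1,\dots,A_N$ be i.i.d. $\mathbb R^d$-valued random vectors with the multivariate $t$-distribution $t_\nu(0,\mathbb 1_d)$, i.e. with Lebesgue density $$x\mapsto\frac{\Gamma((\nu+d)/2)}{\Gamma(\nu/2)\,\nu^{d/2}\pi^{d/2}}\bigl(1+\nu^{-1}\|x\|^2\bigr)^{-(\nu+d)/2},$$ let $B_1,\dots,B_N$ be i.i.d. real random variables with Lebesgue density $\pi_{\mathrm b}$, and let $A=(A_1,\dots,A_N)$ and $B=(B_1,\dots,B_N)$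 be independent. For an $\mathbb R^N$-valued random vector $W$ put $$H^{A,B}_W(x)=\sum_{i=1}^N W_i\max(A_i\cdot x+B_i,0),\qquad x\in\mathbb R^d .$$ Let $C_{\mathrm{Lip}}>0$ and let $\psi\colon\mathbb R^d\to[0,\infty)^d$ be measurable and increasing, i.e. if $x_i\le y_i$ for all $i$, then $\psi_i(x)\le\psi_i(y)$ for all $i$. Let $\Phi\colon\mathbb R^d\to\mathbb R$ satisfy $$|\Phi(x)-\Phi(y)|\le C_{\mathrm{Lip}}\|\psi(x)-\psi(y)\|,\qquad x,y\in\mathbb R^d,$$ and let $V$ be an $\mathbb R^d$-valued random vector with $|\mathbb E[e^{i\xi\cdot V}]|\le\exp(-C\|\xi\|^2)$ for all $\xi\in\mathbb R^d$ and $\mathbb E[\|\psi(M\mathbf 1+V)\|^2]<\infty$, where $\mathbf 1=(1,\dots,1)$ and $\|\cdot\|$ is the Euclidean norm. Let $H(x)=\mathbb E[\Phi(x+V)]$. Then for every $R>0$ there exists an $\mathbb R^N$-valued, $\sigma(A,B)$-measurable random vector $W$ such that, with $B_M(0)=\{x\in\mathbb R^d:\|x\|\le M\}$, the random variable $\sup_{x\in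 B_M(0)}|H^{A,B}_W(x)-H(x)|$ is measurable and $$\mathbb E\Bigl[\sup_{x\in B_M(0)}\bigl|H^{A,B}_W(x)-H(x)\bigr|\Bigr]\le\frac{C_{\mathrm{app}}\,\mathcal I(R)\,(\nu+d)^{k+3}}{\sqrt N}+C_{\mathrm{mom}}\,\mathbb P(\|V\|>R)^{1/2},$$ where $\mathcal I(R)=\int_{\{\|x\|\le M+R\}}|\Phi(x)|\,dx$ and $C_{\mathrm{mom}}=C_{\mathrm{Lip}}\bigl(\mathbb E[\|\psi(M\mathbf 1+V)\|^2]^{1/2}+\|\psi(0)\|\bigr)+|\Phi(0)|$. -/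

import Mathlib

open MeasureTheory ProbabilityTheory

noncomputable section

namespace RandomNN

/-- Euclidean space of dimension `d`. -/
abbrev E (d : ℕ) : Type := EuclideanSpace ℝ (Fin d)

/-- The ReLU activation function. -/
def relu (z : ℝ) : ℝ := max z 0

/-- The one-hidden-layer network `x ↦ ∑ i, w i * relu (a i · x + b i)` with hidden weights `a`, `b`
and output weights `w`. -/
def network {d N : ℕ} (a : Fin N → E d) (b : Fin N → ℝ) (w : E N) (x : E d) : ℝ :=
  ∑ i, w i * relu (inner ℝ (a i) x + b i)

/-- The Lebesgue density of the multivariate t-distribution with `ν` degrees of freedom, location `0`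
and scale matrix the identity. -/
def studentTDensity (d : ℕ) (ν : ℝ) (x : E d) : ℝ :=
  Real.Gamma ((ν + d) / 2) / (Real.Gamma (ν / 2) * ν ^ ((d : ℝ) / 2) * Real.pi ^ ((d : ℝ) / 2)) *
    (1 + ν⁻¹ * ‖x‖ ^ 2) ^ (-((ν + d) / 2))

/-- The multivariate t-distribution with `ν` degrees of freedom, location `0`, identity scale. -/
def studentT (d : ℕ) (ν : ℝ) : Measure (E d) :=
  volume.withDensity fun x => ENNReal.ofReal (studentTDensity d ν x)

/-- A density on the line has at most polynomial decay: `1 ≤ p * f` everywhere for some polynomial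
`p` with strictly positive values. -/
def AtMostPolynomialDecay (f : ℝ → ℝ) : Prop :=
  ∃ p : Polynomial ℝ, ∀ z : ℝ, 0 < p.eval z ∧ 1 ≤ p.eval z * f z

/-- The random hidden weights: `A 1, …, A N` are i.i.d. with the multivariate t-distribution,
`B 1, …, B N` are i.i.d. with Lebesgue density `f`, and the families `A` and `B` are independent. -/
structure IsHiddenWeights {Ω : Type*} [MeasurableSpace Ω] (P : Measure Ω) {d N : ℕ} (ν : ℝ)
    (f : ℝ → ℝ) (A : Fin N → Ω → E d) (B : Fin N → Ω → ℝ) : Prop where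
  measurable_A : ∀ i, Measurable (A i)
  measurable_B : ∀ i, Measurable (B i)
  law_A : ∀ i, P.map (A i) = studentT d ν
  law_B : ∀ i, P.map (B i) = volume.withDensity fun z => ENNReal.ofReal (f z)
  iIndep_A : iIndepFun A P
  iIndep_B : iIndepFun B P
  indep_AB : IndepFun (fun ω i => A i ω) (fun ω i => B i ω) P

/-- The σ-algebra generated by the hidden weights `A` and `B`. -/
@[reducible] def sigmaAB {Ω : Type*} {d N : ℕ} (A : Fin N → Ω → E d) (B : Fin N → Ω → ℝ) : MeasurableSpace Ω :=
  MeasurableSpace.comap (fun ω => ((fun i => A i ω, fun i => B i ω) : (Fin N → E d) × (Fin N → ℝ)))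
    inferInstance

/-- A map `ψ` of `ℝ^d` into itself is increasing for the coordinatewise order. -/
def Increasing {d : ℕ} (ψ : E d → E d) : Prop :=
  ∀ x y : E d, (∀ i, x i ≤ y i) → ∀ i, ψ x i ≤ ψ y i

/-- The vector `(c, …, c)` of `ℝ^d`. -/
def constVec (d : ℕ) (c : ℝ) : E d := WithLp.toLp 2 fun _ => c

/-- The uniform error of the network with output weights `w` on the closed ball of radius `M`. -/
def supError {d N : ℕ} (M : ℝ) (H : E d → ℝ) (a : Fin N → E d) (b : Fin N → ℝ) (w : E N) :
    ENNReal :=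
  ⨆ x ∈ Metric.closedBall (0 : E d) M, ENNReal.ofReal |network a b w x - H x|

end RandomNN

end

/-!
The smoothed function `H` is a superposition of ReLU features, and the network is a Monte Carlo
average of these features, with importance weights that correct for the law of the hidden weights.

*Cut-off.* Replacing `Φ` by `F = Φ` on the ball of radius `M + R` and `0` elsewhere changes `H` on
the ball of radius `M` only on the event `R < ‖V‖`. As `ψ` is nonnegative and increasing,
`Φ (x + V)` is bounded by a constant plus a multiple of `‖ψ (M 1 + V)‖`, and Cauchy–Schwarz gives
the second term of the bound (`abs_integral_sub_integral_indicator_le`).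

*Fourier representation.* The law of `V` has an integrable characteristic function, hence a density
given by the inversion formula, and `x ↦ 𝔼 F (x + V)` equals `Re ∫ g ξ exp (i ⟨x, ξ⟩) dξ` where
`‖g ξ‖ ≤ (2 π) ^ (-d) ‖F‖₁ exp (-C ‖ξ‖ ^ 2)` (`integral_translate_eq`, `norm_waveAmplitude_le`).

*ReLU representation.* On `[-L, L]` Taylor's formula writes `u ↦ exp (i u)` as an integral of
`relu (u + b)` against a bounded weight supported in `|b| ≤ L + 1`
(`integral_expWeight_mul_relu`). With `L = M ‖ξ‖` and `u = ⟨x, ξ⟩` this turns the Fourier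
representation into an integral over features `relu (⟨a, x⟩ + b)`, which is the mean of the network
once the weights are divided by the density of `(a, b)` (`integral_importanceWeight_mul_relu`).

*Variance.* The second moment of the weighted features is finite because the t-density decays
polynomially whereas `g` decays like a Gaussian. The estimate `x ^ m exp (-x) ≤ Γ (m + 1)` cancels
the Gamma function in the normalizing constant, and the factors exponential in the dimension combine
to `(4 π c) ^ (-d)` with `c = 3 C / 4`, which is at most `1` by the assumption on `C`
(`exists_lintegral_importanceWeight_le`).

*Uniform deviation.* Symmetrization by random signs and the contraction principle, which removes the
ReLU, bound the expected supremum of the centred average by `N ^ (-1/2)` times the root of the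
second moment, independently of the dimension (`integral_sup_relu_centered_le`).
The supremum is taken over finite sets first, and over a dense sequence by monotone convergence.

The supremum over the ball is measurable since `H` is continuous there: it is the uniform limit of
the smoothed cut-off functions as the radius of the cut-off tends to infinity.
-/

namespace RandomNN

/-! ### Complex exponentials as superpositions of ReLU functions -/

/-- The output weight attached to the bias `b` in the representation of `u ↦ exp (i u)` on `[-L, L]`
by the functions `u ↦ relu (u + b)`. The part on `[-L, L]` is the second derivative in Taylor's
formula at `-L`; the biases in `(L, L + 1]`, for which `relu (u + b) = u + b`, produce the
affine part. -/
noncomputable def expWeight (L b : ℝ) : ℂ :=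
  (Set.Ioc (-L) L).indicator (fun b => -Complex.exp (-(Complex.I * b))) b +
    (Set.Ioc L (L + 1)).indicator (fun b => Complex.exp (-(Complex.I * L)) *
      (Complex.I * (4 - 6 * (b - L)) + (-6 + 12 * (b - L)))) b

lemma measurable_expWeight : Measurable fun p : ℝ × ℝ => expWeight p.1 p.2 := by
  have e : (fun p : ℝ × ℝ => expWeight p.1 p.2) = fun p =>
      {p : ℝ × ℝ | -p.1 < p.2 ∧ p.2 ≤ p.1}.indicator
        (fun p => -Complex.exp (-(Complex.I * p.2))) p +
      {p : ℝ × ℝ | p.1 < p.2 ∧ p.2 ≤ p.1 + 1}.indicator (fun p =>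
        Complex.exp (-(Complex.I * p.1)) *
          (Complex.I * (4 - 6 * (p.2 - p.1)) + (-6 + 12 * (p.2 - p.1)))) p := by
    funext p
    simp only [expWeight, Set.indicator_apply, Set.mem_Ioc, Set.mem_ofPred_eq]
  rw [e]
  refine (Measurable.indicator (by fun_prop) ?_).add (Measurable.indicator (by fun_prop) ?_)
  · exact (measurableSet_lt measurable_fst.neg measurable_snd).inter
      (measurableSet_le measurable_snd measurable_fst)
  · exact (measurableSet_lt measurable_fst measurable_snd).inter
      (measurableSet_le measurable_snd (measurable_fst.add_const 1))

lemma norm_cexp_neg_I_mul (b : ℝ) : ‖Complex.exp (-(Complex.I * b))‖ = 1 := by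
  simp [Complex.norm_exp]

lemma norm_expWeight_le (L b : ℝ) : ‖expWeight L b‖ ≤ 11 := by
  refine (norm_add_le _ _).trans ?_
  have h1 : ‖(Set.Ioc (-L) L).indicator (fun b : ℝ => -Complex.exp (-(Complex.I * b))) b‖ ≤ 1 :=
    (norm_indicator_le_norm_self _ _).trans (by rw [norm_neg, norm_cexp_neg_I_mul])
  have h2 : ‖(Set.Ioc L (L + 1)).indicator (fun b : ℝ => Complex.exp (-(Complex.I * L)) *
      (Complex.I * (4 - 6 * (b - L)) + (-6 + 12 * (b - L)))) b‖ ≤ 10 := by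
    by_cases hb : b ∈ Set.Ioc L (L + 1)
    · rw [Set.indicator_of_mem hb, norm_mul, norm_cexp_neg_I_mul, one_mul]
      refine (norm_add_le _ _).trans ?_
      rw [norm_mul, Complex.norm_I, one_mul]
      have e1 : ‖(4 - 6 * (b - L) : ℂ)‖ = |4 - 6 * (b - L)| := by
        rw [← Real.norm_eq_abs, ← Complex.norm_real]; push_cast; rfl
      have e2 : ‖(-6 + 12 * (b - L) : ℂ)‖ = |-6 + 12 * (b - L)| := by
        rw [← Real.norm_eq_abs, ← Complex.norm_real]; push_cast; rfl
      rw [e1, e2]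
      obtain ⟨hb1, hb2⟩ := hb
      have a1 : |4 - 6 * (b - L)| ≤ 4 := abs_le.2 ⟨by linarith, by linarith⟩
      have a2 : |-6 + 12 * (b - L)| ≤ 6 := abs_le.2 ⟨by linarith, by linarith⟩
      linarith
    · rw [Set.indicator_of_notMem hb]; norm_num
  linarith

lemma expWeight_eq_zero {L b : ℝ} (hL : 0 ≤ L) (hb : L + 1 < |b|) : expWeight L b = 0 := by
  have h1 : b ∉ Set.Ioc (-L) L := fun h => by
    have : |b| ≤ L := abs_le.2 ⟨h.1.le, h.2⟩
    linarith
  have h2 : b ∉ Set.Ioc L (L + 1) := fun h => by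
    have : |b| ≤ L + 1 := abs_le.2 ⟨by linarith [h.1], h.2⟩
    linarith
  simp [expWeight, h1, h2]

lemma relu_of_nonneg {z : ℝ} (h : 0 ≤ z) : relu z = z := max_eq_left h

lemma relu_of_nonpos {z : ℝ} (h : z ≤ 0) : relu z = 0 := max_eq_right h

lemma continuous_relu : Continuous relu := continuous_id.max continuous_const

lemma expWeight_mul (L : ℝ) (h : ℝ → ℂ) :
    (fun b => expWeight L b * h b) = fun b =>
      (Set.Ioc (-L) L).indicator (fun b => -Complex.exp (-(Complex.I * b)) * h b) b +
      (Set.Ioc L (L + 1)).indicator (fun b => Complex.exp (-(Complex.I * L)) *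
        (Complex.I * (4 - 6 * (b - L)) + (-6 + 12 * (b - L))) * h b) b := by
  funext b
  simp only [expWeight, add_mul, Set.indicator_apply, ite_mul, zero_mul]

lemma continuous_relu_add (u : ℝ) : Continuous fun b : ℝ => (relu (u + b) : ℂ) :=
  Complex.continuous_ofReal.comp (continuous_relu.comp (continuous_const.add continuous_id))

lemma integrable_expWeight_mul_relu (L u : ℝ) :
    Integrable fun b => expWeight L b * (relu (u + b) : ℂ) := by
  rw [expWeight_mul]
  refine Integrable.add ?_ ?_ <;>
  · refine (Continuous.integrableOn_Ioc ?_).integrable_indicator measurableSet_Ioc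
    exact Continuous.mul (by fun_prop) (continuous_relu_add u)

/-- `exp (i u)` on `[-L, L]` is a superposition of ReLU functions with bounded weights whose biases
lie in `[-L, L + 1]`. -/
lemma integral_expWeight_mul_relu {L u : ℝ} (hu : |u| ≤ L) :
    ∫ b, expWeight L b * (relu (u + b) : ℂ) = Complex.exp (Complex.I * u) := by
  have hL : 0 ≤ L := (abs_nonneg u).trans hu
  obtain ⟨hu1, hu2⟩ := abs_le.1 hu
  set f : ℝ → ℂ := fun b => -Complex.exp (-(Complex.I * b)) * (relu (u + b) : ℂ) with hf
  set g : ℝ → ℂ := fun b => Complex.exp (-(Complex.I * L)) *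
    (Complex.I * (4 - 6 * (b - L)) + (-6 + 12 * (b - L))) * (relu (u + b) : ℂ) with hg
  have hfc : Continuous f := by
    refine Continuous.mul (by fun_prop) (continuous_relu_add u)
  have hgc : Continuous g := by
    refine Continuous.mul (by fun_prop) (continuous_relu_add u)
  have e : (fun b => expWeight L b * (relu (u + b) : ℂ)) = fun b =>
      (Set.Ioc (-L) L).indicator f b + (Set.Ioc L (L + 1)).indicator g b := expWeight_mul L _
  rw [e, integral_add (hfc.integrableOn_Ioc.integrable_indicator measurableSet_Ioc)
    (hgc.integrableOn_Ioc.integrable_indicator measurableSet_Ioc),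
    integral_indicator measurableSet_Ioc, integral_indicator measurableSet_Ioc,
    ← intervalIntegral.integral_of_le (by linarith),
    ← intervalIntegral.integral_of_le (by linarith),
    ← intervalIntegral.integral_add_adjacent_intervals (b := -u) (hfc.intervalIntegrable _ _)
      (hfc.intervalIntegrable _ _)]
  -- The integrand vanishes below `-u`; above, `-e^{-ib} (u + b)` has an explicit antiderivative.
  have h1 : ∫ b in (-L)..(-u), f b = 0 := by
    refine intervalIntegral.integral_zero_ae (ae_of_all _ fun b hb => ?_)
    rw [Set.uIoc_of_le (by linarith)] at hb
    simp [hf, relu_of_nonpos (show u + b ≤ 0 by linarith [hb.2])]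
  have h2 : ∫ b in (-u)..L, f b =
      (-Complex.I * (u + L) - 1) * Complex.exp (-(Complex.I * L)) +
        Complex.exp (Complex.I * u) := by
    have hd : ∀ b : ℝ, HasDerivAt (fun b : ℝ => (-Complex.I * (u + b) - 1) *
        Complex.exp (-(Complex.I * b))) (-Complex.exp (-(Complex.I * b)) * (u + b)) b := by
      intro b
      have hb : HasDerivAt (fun b : ℝ => (b : ℂ)) 1 b := Complex.ofRealCLM.hasDerivAt
      have := (((hb.const_add (u : ℂ)).const_mul (-Complex.I)).sub_const 1).mul
        ((hb.const_mul Complex.I).neg.cexp)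
      refine this.congr_deriv ?_
      simp only [Pi.neg_apply]
      linear_combination ((u + b) * Complex.exp (-(Complex.I * b))) * Complex.I_sq
    rw [intervalIntegral.integral_congr (g := fun b : ℝ =>
      -Complex.exp (-(Complex.I * b)) * (u + b)), intervalIntegral.integral_eq_sub_of_hasDerivAt
        (fun b _ => hd b)]
    · push_cast
      simp
    · exact Continuous.intervalIntegrable (by fun_prop) _ _
    · intro b hb
      rw [Set.uIcc_of_le (by linarith)] at hb
      simp [hf, relu_of_nonneg (show 0 ≤ u + b by linarith [hb.1])]
  -- The two affine weights are dual to `1` and `b - L` on `[L, L + 1]`, so this part returns the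
  -- Taylor polynomial of degree one at `-L`.
  have h3 : ∫ b in L..(L + 1), g b =
      Complex.exp (-(Complex.I * L)) * (Complex.I * (u + L) + 1) := by
    have hd : ∀ b : ℝ, HasDerivAt (fun b : ℝ => Complex.exp (-(Complex.I * L)) *
        (Complex.I * ((u + L) * (4 * (b - L) - 3 * (b - L) ^ 2) +
            (2 * (b - L) ^ 2 - 2 * (b - L) ^ 3)) +
          ((u + L) * (-6 * (b - L) + 6 * (b - L) ^ 2) + (-3 * (b - L) ^ 2 + 4 * (b - L) ^ 3))))
        (Complex.exp (-(Complex.I * L)) *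
          (Complex.I * (4 - 6 * (b - L)) + (-6 + 12 * (b - L))) * (u + b)) b := by
      intro b
      have hb : HasDerivAt (fun b : ℝ => (b : ℂ) - L) 1 b :=
        (Complex.ofRealCLM.hasDerivAt (x := b)).sub_const (L : ℂ)
      have hb2 := hb.fun_pow 2
      have hb3 := hb.fun_pow 3
      have := (((((hb.const_mul 4).sub (hb2.const_mul 3)).const_mul ((u : ℂ) + L)).add
        ((hb2.const_mul 2).sub (hb3.const_mul 2))).const_mul Complex.I).add
          ((((hb.const_mul (-6)).add (hb2.const_mul 6)).const_mul ((u : ℂ) + L)).add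
            ((hb2.const_mul (-3)).add (hb3.const_mul 4)))
      refine (this.const_mul (Complex.exp (-(Complex.I * L)))).congr_deriv ?_
      push_cast
      ring
    rw [intervalIntegral.integral_congr (g := fun b : ℝ => Complex.exp (-(Complex.I * L)) *
      (Complex.I * (4 - 6 * (b - L)) + (-6 + 12 * (b - L))) * (u + b)),
      intervalIntegral.integral_eq_sub_of_hasDerivAt (fun b _ => hd b)]
    · push_cast
      ring
    · exact Continuous.intervalIntegrable (by fun_prop) _ _
    · intro b hb
      rw [Set.uIcc_of_le (by linarith)] at hb
      simp [hg, relu_of_nonneg (show 0 ≤ u + b by linarith [hb.1])]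
  rw [h1, h2, h3]
  ring

/-! ### Rademacher sums: contraction and second moments -/

lemma le_ciSup_of_fintype {ι : Type*} [Finite ι] (f : ι → ℝ) (x : ι) : f x ≤ ⨆ y, f y :=
  le_ciSup (Set.finite_range f).bddAbove x

lemma sum_units_int {α : Type*} [AddCommMonoid α] (f : ℤˣ → α) : ∑ e, f e = f 1 + f (-1) := by
  rw [UnitsInt.univ, Finset.sum_pair (by decide)]

lemma sum_signs_succ {n : ℕ} (f : (Fin (n + 1) → ℤˣ) → ℝ) :
    ∑ ε, f ε = ∑ e : ℤˣ, ∑ ε : Fin n → ℤˣ, f (Fin.cons e ε) := by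
  rw [← Fintype.sum_prod_type']
  exact (Fintype.sum_equiv (Fin.consEquiv fun _ : Fin (n + 1) => ℤˣ) _ _ fun _ => rfl).symm

/-- The contraction principle for a single random sign. -/
lemma sup_add_sup_neg_le {ι : Type*} [Finite ι] [Nonempty ι] (G s t : ι → ℝ)
    (h : ∀ x y, |s x - s y| ≤ |t x - t y|) :
    (⨆ x, (G x + s x)) + ⨆ x, (G x - s x) ≤ (⨆ x, (G x + t x)) + ⨆ x, (G x - t x) := by
  obtain ⟨x, hx⟩ := exists_eq_ciSup_of_finite (f := fun x => G x + s x)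
  obtain ⟨y, hy⟩ := exists_eq_ciSup_of_finite (f := fun x => G x - s x)
  rw [← hx, ← hy]
  have h1 := le_ciSup_of_fintype (fun x => G x + t x)
  have h2 := le_ciSup_of_fintype (fun x => G x - t x)
  have hs := (le_abs_self _).trans (h x y)
  rcases abs_cases (t x - t y) with ⟨h3, -⟩ | ⟨h3, -⟩
  · linarith [h1 x, h2 y]
  · linarith [h1 y, h2 x]

/-- The contraction principle, with expectations over uniform signs written as sums. The function
`G` is carried along for the induction. -/
lemma sum_signs_sup_le {ι : Type*} [Finite ι] [Nonempty ι] (n : ℕ) (G : ι → ℝ)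
    (s t : Fin n → ι → ℝ) (h : ∀ i x y, |s i x - s i y| ≤ |t i x - t i y|) :
    ∑ ε : Fin n → ℤˣ, ⨆ x, (G x + ∑ i, ((ε i : ℤ) : ℝ) * s i x) ≤
      ∑ ε : Fin n → ℤˣ, ⨆ x, (G x + ∑ i, ((ε i : ℤ) : ℝ) * t i x) := by
  induction n generalizing G with
  | zero => simp
  | succ n ih =>
    simp only [sum_signs_succ, Fin.sum_univ_succ, Fin.cons_zero, Fin.cons_succ, ← add_assoc]
    refine (Finset.sum_le_sum fun (e : ℤˣ) _ => ih (fun x => G x + ((e : ℤ) : ℝ) * s 0 x)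
      (fun i => s i.succ) (fun i => t i.succ) fun i => h i.succ).trans ?_
    rw [Finset.sum_comm, Finset.sum_comm (t := Finset.univ (α := Fin n → ℤˣ))]
    refine Finset.sum_le_sum fun ε _ => ?_
    have := sup_add_sup_neg_le (fun x => G x + ∑ i : Fin n, ((ε i : ℤ) : ℝ) * t i.succ x)
      (s 0) (t 0) (h 0)
    rw [sum_units_int, sum_units_int]
    have hcomm : ∀ x (c : ℝ), G x + c + ∑ i : Fin n, ((ε i : ℤ) : ℝ) * t i.succ x =
        G x + ∑ i : Fin n, ((ε i : ℤ) : ℝ) * t i.succ x + c := fun x c => add_right_comm _ _ _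
    simpa only [hcomm, Units.val_one, Int.cast_one, one_mul, Units.val_neg, Int.cast_neg, neg_mul,
      sub_eq_add_neg] using this

/-- The contraction principle for absolute values. Adjoining an index at which all terms vanish
makes the one-sided suprema nonnegative. -/
lemma sum_signs_sup_abs_le {ι : Type*} [Finite ι] [Nonempty ι] {n : ℕ}
    (s t : Fin n → ι → ℝ) (h : ∀ i x y, |s i x - s i y| ≤ |t i x - t i y|)
    (h0 : ∀ i x, |s i x| ≤ |t i x|) :
    ∑ ε : Fin n → ℤˣ, ⨆ x, |∑ i, ((ε i : ℤ) : ℝ) * s i x| ≤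
      2 * ∑ ε : Fin n → ℤˣ, ⨆ x, |∑ i, ((ε i : ℤ) : ℝ) * t i x| := by
  set s' : Fin n → Option ι → ℝ := fun i x => x.elim 0 (s i) with hs'
  set t' : Fin n → Option ι → ℝ := fun i x => x.elim 0 (t i) with ht'
  have key := sum_signs_sup_le n 0 s' t' (by
    rintro i (_ | x) (_ | y) <;> simp [hs', ht', h, h0])
  simp only [Pi.zero_apply, zero_add] at key
  have hneg : ∑ ε : Fin n → ℤˣ, ⨆ x, ∑ i, (((-ε) i : ℤˣ) : ℤ) * s' i x =
      ∑ ε : Fin n → ℤˣ, ⨆ x, ∑ i, ((ε i : ℤ) : ℝ) * s' i x :=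
    Fintype.sum_equiv (Equiv.neg _) _ _ fun _ => rfl
  have h1 : ∑ ε : Fin n → ℤˣ, ⨆ x, |∑ i, ((ε i : ℤ) : ℝ) * s i x| ≤
      ∑ ε : Fin n → ℤˣ, ((⨆ x, ∑ i, ((ε i : ℤ) : ℝ) * s' i x) +
        ⨆ x, ∑ i, (((-ε) i : ℤˣ) : ℤ) * s' i x) := by
    refine Finset.sum_le_sum fun ε _ => ciSup_le fun x => ?_
    have a1 := le_ciSup_of_fintype (fun x => ∑ i, ((ε i : ℤ) : ℝ) * s' i x)
    have a2 := le_ciSup_of_fintype (fun x => ∑ i, (((-ε) i : ℤˣ) : ℤ) * s' i x)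
    have b1 := a1 none
    have b2 := a2 none
    have c1 := a1 (some x)
    have c2 := a2 (some x)
    simp only [hs', Option.elim_none, mul_zero, Finset.sum_const_zero] at b1 b2
    simp only [hs', Option.elim_some, Pi.neg_apply, Units.val_neg, Int.cast_neg, neg_mul,
      Finset.sum_neg_distrib] at c1 c2 b2 ⊢
    rw [abs_le]
    constructor <;> linarith
  have h2 : ∑ ε : Fin n → ℤˣ, ⨆ x, ∑ i, ((ε i : ℤ) : ℝ) * t' i x ≤
      ∑ ε : Fin n → ℤˣ, ⨆ x, |∑ i, ((ε i : ℤ) : ℝ) * t i x| := by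
    refine Finset.sum_le_sum fun ε _ => ciSup_le ?_
    have a1 := le_ciSup_of_fintype (fun x => |∑ i, ((ε i : ℤ) : ℝ) * t i x|)
    rintro (_ | x)
    · simpa [ht'] using (abs_nonneg _).trans (a1 (Classical.arbitrary ι))
    · exact (le_abs_self _).trans (a1 x)
  rw [Finset.sum_add_distrib, hneg] at h1
  linarith

/-- Orthogonality of the signs. The vector `u` is carried along for the induction. -/
lemma sum_signs_norm_sq {F : Type*} [NormedAddCommGroup F] [InnerProductSpace ℝ F] (n : ℕ) (u : F)
    (v : Fin n → F) :
    ∑ ε : Fin n → ℤˣ, ‖u + ∑ i, ((ε i : ℤ) : ℝ) • v i‖ ^ 2 =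
      2 ^ n * (‖u‖ ^ 2 + ∑ i, ‖v i‖ ^ 2) := by
  induction n generalizing u with
  | zero => simp
  | succ n ih =>
    simp only [sum_signs_succ, Fin.sum_univ_succ, Fin.cons_zero, Fin.cons_succ, ← add_assoc, ih]
    rw [sum_units_int]
    have := parallelogram_law_with_norm ℝ u (v 0)
    simp only [Units.val_one, Units.val_neg, Int.cast_one, Int.cast_neg, one_smul, neg_smul,
      ← sub_eq_add_neg]
    rw [pow_succ]
    linear_combination (2 ^ n) * this

/-- Khintchine's inequality in the easy direction, with the average over the signs written as a
sum. -/
lemma sum_signs_norm_le {F : Type*} [NormedAddCommGroup F] [InnerProductSpace ℝ F] {n : ℕ}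
    (v : Fin n → F) :
    ∑ ε : Fin n → ℤˣ, ‖∑ i, ((ε i : ℤ) : ℝ) • v i‖ ≤ 2 ^ n * Real.sqrt (∑ i, ‖v i‖ ^ 2) := by
  have h := sum_signs_norm_sq n 0 v
  have hc := sq_sum_le_card_mul_sum_sq (s := (Finset.univ : Finset (Fin n → ℤˣ)))
    (f := fun ε => ‖∑ i, ((ε i : ℤ) : ℝ) • v i‖)
  simp only [zero_add, norm_zero, ne_eq, OfNat.ofNat_ne_zero, not_false_eq_true, zero_pow] at h
  rw [h] at hc
  have hcard : ((Finset.univ : Finset (Fin n → ℤˣ)).card : ℝ) = 2 ^ n := by simp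
  rw [hcard] at hc
  have h0 : 0 ≤ ∑ i, ‖v i‖ ^ 2 := Finset.sum_nonneg fun _ _ => sq_nonneg _
  refine (pow_le_pow_iff_left₀ (by positivity) (by positivity) two_ne_zero).1
    (hc.trans (le_of_eq ?_))
  rw [mul_pow, Real.sq_sqrt h0]
  ring

lemma abs_relu_sub_relu_le (s t : ℝ) : |relu s - relu t| ≤ |s - t| := abs_max_sub_max_le_abs s t 0

lemma abs_relu_le (s : ℝ) : |relu s| ≤ |s| := by
  simpa [relu] using abs_relu_sub_relu_le s 0

/-- The Rademacher average of ReLU features over a ball: contraction removes the ReLU, after which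
the supremum of the remaining affine functions is attained explicitly. -/
lemma sum_signs_sup_relu_le {F ι : Type*} [NormedAddCommGroup F] [InnerProductSpace ℝ F] [Finite ι]
    [Nonempty ι] {n : ℕ} {M : ℝ} (x : ι → F) (hx : ∀ j, ‖x j‖ ≤ M) (c b : Fin n → ℝ)
    (a : Fin n → F) :
    ∑ ε : Fin n → ℤˣ, ⨆ j, |∑ i, ((ε i : ℤ) : ℝ) * (c i * relu (inner ℝ (a i) (x j) + b i))| ≤
      2 ^ n * (2 * (M * Real.sqrt (∑ i, (c i * ‖a i‖) ^ 2) +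
        Real.sqrt (∑ i, (c i * b i) ^ 2))) := by
  have hM : 0 ≤ M := (norm_nonneg _).trans (hx (Classical.arbitrary ι))
  refine (sum_signs_sup_abs_le _ (fun i j => c i * (inner ℝ (a i) (x j) + b i)) ?_ ?_).trans ?_
  · intro i j k
    rw [← mul_sub, ← mul_sub, abs_mul, abs_mul]
    exact mul_le_mul_of_nonneg_left (abs_relu_sub_relu_le _ _) (abs_nonneg _)
  · intro i j
    rw [abs_mul, abs_mul]
    exact mul_le_mul_of_nonneg_left (abs_relu_le _) (abs_nonneg _)
  have h1 := sum_signs_norm_le fun i => c i • a i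
  have h2 := sum_signs_norm_le fun i => c i * b i
  have h3 : ∑ ε : Fin n → ℤˣ, ⨆ j, |∑ i, ((ε i : ℤ) : ℝ) * (c i * (inner ℝ (a i) (x j) + b i))| ≤
      ∑ ε : Fin n → ℤˣ, (M * ‖∑ i, ((ε i : ℤ) : ℝ) • (c i • a i)‖ +
        ‖∑ i, ((ε i : ℤ) : ℝ) • (c i * b i)‖) := by
    refine Finset.sum_le_sum fun ε _ => ciSup_le fun j => ?_
    have : ∑ i, ((ε i : ℤ) : ℝ) * (c i * (inner ℝ (a i) (x j) + b i)) =
        inner ℝ (∑ i, ((ε i : ℤ) : ℝ) • (c i • a i)) (x j) +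
          ∑ i, ((ε i : ℤ) : ℝ) • (c i * b i) := by
      simp only [sum_inner, inner_smul_left, smul_eq_mul, conj_trivial, ← Finset.sum_add_distrib]
      exact Finset.sum_congr rfl fun i _ => by ring
    rw [this, Real.norm_eq_abs]
    refine (abs_add_le _ _).trans (add_le_add ?_ le_rfl)
    rw [mul_comm]
    exact (abs_real_inner_le_norm _ _).trans (mul_le_mul_of_nonneg_left (hx j) (norm_nonneg _))
  rw [Finset.sum_add_distrib, ← Finset.mul_sum] at h3
  simp only [norm_smul, Real.norm_eq_abs, mul_pow, sq_abs] at h1 h2 h3 ⊢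
  have := mul_le_mul_of_nonneg_left h1 hM
  linarith

/-! ### Symmetrization of an empirical process -/

section Symmetrization

variable {Z ι : Type*} [MeasurableSpace Z] {n : ℕ}

lemma measurable_ciSup_abs [Finite ι] {f : ι → Z → ℝ} (hf : ∀ j, Measurable (f j)) :
    Measurable fun z => ⨆ j, |f j z| :=
  Measurable.iSup fun j => (hf j).abs

lemma ciSup_abs_nonneg (f : ι → ℝ) : 0 ≤ ⨆ j, |f j| := Real.iSup_nonneg fun _ => abs_nonneg _

lemma integrable_ciSup_abs [Fintype ι] [Nonempty ι] {μ : Measure Z} {f : ι → Z → ℝ}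
    (hm : ∀ j, Measurable (f j)) (hf : ∀ j, Integrable (f j) μ) :
    Integrable (fun z => ⨆ j, |f j z|) μ := by
  refine (integrable_finsetSum Finset.univ fun j _ => (hf j).abs).mono'
    (measurable_ciSup_abs hm).aestronglyMeasurable (ae_of_all _ fun z => ?_)
  rw [Real.norm_of_nonneg (ciSup_abs_nonneg _)]
  exact ciSup_le fun j => Finset.single_le_sum (f := fun j => |f j z|) (fun _ _ => abs_nonneg _)
    (Finset.mem_univ j)

variable (μ : Measure Z) [IsProbabilityMeasure μ]

/-- Exchanging a sample with its independent copy at the coordinates of negative sign does not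
change the joint law. -/
lemma measurePreserving_swap_signs (ε : Fin n → ℤˣ) :
    MeasurePreserving
      (fun p : (Fin n → Z) × (Fin n → Z) =>
        ((fun i => if ε i = 1 then p.1 i else p.2 i : Fin n → Z),
          (fun i => if ε i = 1 then p.2 i else p.1 i : Fin n → Z)))
      ((Measure.pi fun _ => μ).prod (Measure.pi fun _ => μ))
      ((Measure.pi fun _ => μ).prod (Measure.pi fun _ => μ)) := by
  have he := measurePreserving_arrowProdEquivProdArrow Z Z (Fin n) (fun _ => μ) (fun _ => μ)
  have hf : ∀ i, MeasurePreserving (fun q : Z × Z => if ε i = 1 then q else q.swap)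
      (μ.prod μ) (μ.prod μ) := by
    intro i
    by_cases h : ε i = 1
    · simp only [h, if_true]
      exact MeasurePreserving.id (μ.prod μ)
    · simpa [h] using Measure.measurePreserving_swap
  have := (he.comp (measurePreserving_pi _ _ hf)).comp (he.symm _)
  convert this using 1
  funext p
  refine Prod.ext ?_ ?_ <;> funext i <;> by_cases h : ε i = 1 <;>
    simp [MeasurableEquiv.arrowProdEquivProdArrow, Equiv.arrowProdEquivProdArrow, h]

lemma integrable_comp_eval {f : Z → ℝ} (hf : Integrable f μ) (i : Fin n) :
    Integrable (fun z : Fin n → Z => f (z i)) (Measure.pi fun _ => μ) :=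
  (measurePreserving_eval (fun _ : Fin n => μ) i).integrable_comp_of_integrable hf

lemma integral_comp_eval {f : Z → ℝ} (hf : Measurable f) (i : Fin n) :
    ∫ z : Fin n → Z, f (z i) ∂(Measure.pi fun _ => μ) = ∫ z, f z ∂μ := by
  have hp := measurePreserving_eval (fun _ : Fin n => μ) i
  conv_rhs => rw [← hp.map_eq]
  exact (integral_map hp.measurable.aemeasurable hf.aestronglyMeasurable).symm

/-- Symmetrization, for one fixed choice of the signs. -/
lemma integral_sup_centered_le [Fintype ι] [Nonempty ι] {h : ι → Z → ℝ}
    (hm : ∀ j, Measurable (h j)) (hi : ∀ j, Integrable (h j) μ) (ε : Fin n → ℤˣ) :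
    ∫ z : Fin n → Z, ⨆ j, |∑ i, (h j (z i) - ∫ y, h j y ∂μ)| ∂(Measure.pi fun _ => μ) ≤
      2 * ∫ z : Fin n → Z, ⨆ j, |∑ i, ((ε i : ℤ) : ℝ) * h j (z i)| ∂(Measure.pi fun _ => μ) := by
  set π : Measure (Fin n → Z) := Measure.pi fun _ => μ with hπ
  have hev : ∀ j i, Integrable (fun z : Fin n → Z => h j (z i)) π :=
    fun j i => integrable_comp_eval μ (hi j) i
  have hmev : ∀ j i, Measurable (fun z : Fin n → Z => h j (z i)) :=
    fun j i => (hm j).comp (measurable_pi_apply i)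
  set D : (Fin n → Z) × (Fin n → Z) → ℝ := fun p => ⨆ j, |∑ i, (h j (p.1 i) - h j (p.2 i))| with hD
  set S : (Fin n → Z) → ℝ := fun z => ⨆ j, |∑ i, ((ε i : ℤ) : ℝ) * h j (z i)| with hS
  have hDm : Measurable D := measurable_ciSup_abs fun j => Finset.measurable_sum _ fun i _ =>
    ((hmev j i).comp measurable_fst).sub ((hmev j i).comp measurable_snd)
  have hDi : Integrable D (π.prod π) := by
    refine integrable_ciSup_abs (fun j => Finset.measurable_sum _ fun i _ =>
      ((hmev j i).comp measurable_fst).sub ((hmev j i).comp measurable_snd)) fun j =>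
      integrable_finsetSum _ fun i _ => ?_
    exact ((hev j i).comp_fst π).sub ((hev j i).comp_snd π)
  have hSi : Integrable S π :=
    integrable_ciSup_abs (fun j => Finset.measurable_sum _ fun i _ => (hmev j i).const_mul _)
      fun j => integrable_finsetSum _ fun i _ => (hev j i).const_mul _
  -- The mean is the expectation over an independent copy, which can be pulled out of the supremum.
  have hstep1 : ∫ z, ⨆ j, |∑ i, (h j (z i) - ∫ y, h j y ∂μ)| ∂π ≤ ∫ p, D p ∂(π.prod π) := by
    rw [integral_prod _ hDi]
    refine integral_mono ?_ hDi.integral_prod_left fun z => ciSup_le fun j => ?_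
    · exact integrable_ciSup_abs
        (fun j => Finset.measurable_sum _ fun i _ => (hmev j i).sub measurable_const)
        fun j => integrable_finsetSum _ fun i _ => (hev j i).sub (integrable_const _)
    · have hci : ∀ j i, Integrable (fun z' : Fin n → Z => h j (z i) - h j (z' i)) π :=
        fun j i => (integrable_const _).sub (hev j i)
      have hzm : ∀ j, Measurable (fun z' : Fin n → Z => ∑ i, (h j (z i) - h j (z' i))) :=
        fun j => Finset.measurable_sum _ fun i _ => (hmev j i).const_sub _
      have hzi : ∀ j, Integrable (fun z' : Fin n → Z => ∑ i, (h j (z i) - h j (z' i))) π :=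
        fun j => integrable_finsetSum _ fun i _ => hci j i
      have : ∑ i, (h j (z i) - ∫ y, h j y ∂μ) = ∫ z', ∑ i, (h j (z i) - h j (z' i)) ∂π := by
        rw [integral_finsetSum _ fun i _ => hci j i]
        refine Finset.sum_congr rfl fun i _ => ?_
        rw [integral_sub (integrable_const _) (hev j i), integral_comp_eval μ (hm j) i]
        simp
      rw [this]
      refine abs_integral_le_integral_abs.trans
        (integral_mono (hzi j).abs (integrable_ciSup_abs hzm hzi) fun z' => ?_)
      exact le_ciSup_of_fintype (fun j => |∑ i, (h j (z i) - h j (z' i))|) j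
  have hmp := measurePreserving_swap_signs μ ε
  rw [← hπ] at hmp
  have hstep2 : ∫ p, D p ∂(π.prod π) ≤ ∫ p, (S p.1 + S p.2) ∂(π.prod π) := by
    conv_lhs => rw [← hmp.map_eq]
    rw [integral_map hmp.measurable.aemeasurable hDm.aestronglyMeasurable]
    refine integral_mono (hmp.integrable_comp_of_integrable hDi)
      ((hSi.comp_fst π).add (hSi.comp_snd π)) fun p => ciSup_le fun j => ?_
    have e : ∑ i, (h j (if ε i = 1 then p.1 i else p.2 i) -
        h j (if ε i = 1 then p.2 i else p.1 i)) =
        ∑ i, ((ε i : ℤ) : ℝ) * h j (p.1 i) - ∑ i, ((ε i : ℤ) : ℝ) * h j (p.2 i) := by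
      rw [← Finset.sum_sub_distrib]
      refine Finset.sum_congr rfl fun i _ => ?_
      rcases Int.units_eq_one_or (ε i) with h | h
      · simp [h]
      · simp [h]
        ring
    simp only [e]
    exact (abs_sub _ _).trans (add_le_add
      (le_ciSup_of_fintype (fun j => |∑ i, ((ε i : ℤ) : ℝ) * h j (p.1 i)|) j)
      (le_ciSup_of_fintype (fun j => |∑ i, ((ε i : ℤ) : ℝ) * h j (p.2 i)|) j))
  refine (hstep1.trans hstep2).trans (le_of_eq ?_)
  rw [integral_add (hSi.comp_fst π) (hSi.comp_snd π), integral_fun_fst, integral_fun_snd]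
  simp [two_mul]

end Symmetrization

lemma integral_sqrt_le {Z : Type*} [MeasurableSpace Z] (μ : Measure Z) [IsProbabilityMeasure μ]
    {f : Z → ℝ} (hf : Integrable f μ) (h0 : ∀ z, 0 ≤ f z)
    (hs : Integrable (fun z => Real.sqrt (f z)) μ) :
    ∫ z, Real.sqrt (f z) ∂μ ≤ Real.sqrt (∫ z, f z ∂μ) :=
  Real.strictConcaveOn_sqrt.concaveOn.le_map_integral Real.continuous_sqrt.continuousOn isClosed_Ici
    (ae_of_all _ h0) hf hs

/-- A ReLU feature is dominated by its weighted square, which is the quantity controlled by the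
second moment bound. -/
lemma abs_mul_relu_le {F : Type*} [NormedAddCommGroup F] [InnerProductSpace ℝ F] (c b M : ℝ)
    (a x : F) (hx : ‖x‖ ≤ M) :
    |c * relu (inner ℝ a x + b)| ≤ (M + 1) * (1 + c ^ 2 * (‖a‖ ^ 2 + b ^ 2)) := by
  have hM : 0 ≤ M := (norm_nonneg _).trans hx
  have h1 : |c| * ‖a‖ ≤ 1 + c ^ 2 * (‖a‖ ^ 2 + b ^ 2) := by
    nlinarith [sq_nonneg (|c| * ‖a‖ - 1), sq_abs c, sq_nonneg (c * b), sq_nonneg (|c| * ‖a‖)]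
  have h2 : |c| * |b| ≤ 1 + c ^ 2 * (‖a‖ ^ 2 + b ^ 2) := by
    nlinarith [sq_nonneg (|c| * |b| - 1), sq_abs c, sq_abs b, sq_nonneg (c * ‖a‖),
      sq_nonneg (|c| * |b|)]
  have h3 : |relu (inner ℝ a x + b)| ≤ ‖a‖ * M + |b| :=
    (abs_relu_le _).trans ((abs_add_le _ _).trans (add_le_add
      ((abs_real_inner_le_norm _ _).trans (mul_le_mul_of_nonneg_left hx (norm_nonneg _))) le_rfl))
  rw [abs_mul]
  have h4 := mul_le_mul_of_nonneg_left h3 (abs_nonneg c)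
  have h5 := mul_le_mul_of_nonneg_right h1 hM
  linarith

lemma integrable_of_lintegral_ofReal_le {Z : Type*} [MeasurableSpace Z] {μ : Measure Z}
    {S : Z → ℝ} (hm : Measurable S) (h0 : ∀ z, 0 ≤ S z) {K : ℝ}
    (hL : ∫⁻ z, ENNReal.ofReal (S z) ∂μ ≤ ENNReal.ofReal K) : Integrable S μ := by
  refine ⟨hm.aestronglyMeasurable, ?_⟩
  rw [hasFiniteIntegral_iff_ofReal (ae_of_all _ h0)]
  exact hL.trans_lt ENNReal.ofReal_lt_top

lemma integrable_mul_relu {Z F : Type*} [MeasurableSpace Z] [NormedAddCommGroup F]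
    [InnerProductSpace ℝ F] [MeasurableSpace F] [BorelSpace F] [SecondCountableTopology F]
    {μ : Measure Z} [IsFiniteMeasure μ] {c b : Z → ℝ} {a : Z → F} (hc : Measurable c)
    (hb : Measurable b) (ha : Measurable a) {K M : ℝ}
    (hL : ∫⁻ z, ENNReal.ofReal ((c z) ^ 2 * (‖a z‖ ^ 2 + (b z) ^ 2)) ∂μ ≤ ENNReal.ofReal K)
    {x : F} (hx : ‖x‖ ≤ M) : Integrable (fun z => c z * relu (inner ℝ (a z) x + b z)) μ := by
  have hSi := integrable_of_lintegral_ofReal_le (by fun_prop) (fun z => by positivity) hL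
  exact (((integrable_const (1 : ℝ)).add hSi).const_mul (M + 1)).mono'
    (hc.mul (((ha.inner measurable_const).add hb).max measurable_const)).aestronglyMeasurable
    (ae_of_all _ fun z => abs_mul_relu_le _ _ _ _ _ hx)

/-- The expected uniform deviation of an average of weighted ReLU features from its mean, over
finitely many points of a ball: the rate does not depend on the number of points or on the
dimension. -/
lemma integral_sup_relu_centered_le {Z ι F : Type*} [MeasurableSpace Z] [Fintype ι] [Nonempty ι]
    [NormedAddCommGroup F] [InnerProductSpace ℝ F] [MeasurableSpace F] [BorelSpace F]
    [SecondCountableTopology F] (μ : Measure Z) [IsProbabilityMeasure μ]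
    {c b : Z → ℝ} {a : Z → F} (hc : Measurable c) (hb : Measurable b) (ha : Measurable a)
    {K M : ℝ} (hK : 0 ≤ K) (hM : 0 ≤ M)
    (hL : ∫⁻ z, ENNReal.ofReal ((c z) ^ 2 * (‖a z‖ ^ 2 + (b z) ^ 2)) ∂μ ≤ ENNReal.ofReal K)
    (x : ι → F) (hx : ∀ j, ‖x j‖ ≤ M) (n : ℕ) :
    ∫ z : Fin n → Z, ⨆ j, |∑ i, (c (z i) * relu (inner ℝ (a (z i)) (x j) + b (z i)) -
        ∫ y, c y * relu (inner ℝ (a y) (x j) + b y) ∂μ)| ∂(Measure.pi fun _ => μ) ≤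
      4 * (M + 1) * Real.sqrt n * Real.sqrt K := by
  set S : Z → ℝ := fun z => (c z) ^ 2 * (‖a z‖ ^ 2 + (b z) ^ 2) with hS
  have hS0 : ∀ z, 0 ≤ S z := fun z => by positivity
  have hSm : Measurable S := by fun_prop
  have hSi : Integrable S μ := integrable_of_lintegral_ofReal_le hSm hS0 hL
  have hSK : ∫ z, S z ∂μ ≤ K := by
    rwa [← ENNReal.ofReal_le_ofReal_iff hK, ofReal_integral_eq_lintegral_ofReal hSi
      (ae_of_all _ hS0)]
  have hm : ∀ j, Measurable fun z => c z * relu (inner ℝ (a z) (x j) + b z) := fun j =>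
    hc.mul (((ha.inner measurable_const).add hb).max measurable_const)
  have hi : ∀ j, Integrable (fun z => c z * relu (inner ℝ (a z) (x j) + b z)) μ := fun j =>
    integrable_mul_relu hc hb ha hL (hx j)
  set π : Measure (Fin n → Z) := Measure.pi fun _ => μ with hπ
  set L := ∫ z : Fin n → Z, ⨆ j, |∑ i, (c (z i) * relu (inner ℝ (a (z i)) (x j) + b (z i)) -
        ∫ y, c y * relu (inner ℝ (a y) (x j) + b y) ∂μ)| ∂π with hLdef
  have hTi : Integrable (fun z : Fin n → Z => ∑ i, S (z i)) π :=
    integrable_finsetSum _ fun i _ => integrable_comp_eval μ hSi i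
  have hT0 : ∀ z : Fin n → Z, 0 ≤ ∑ i, S (z i) := fun z => Finset.sum_nonneg fun i _ => hS0 _
  have hTm : Measurable fun z : Fin n → Z => ∑ i, S (z i) :=
    Finset.measurable_sum _ fun i _ => hSm.comp (measurable_pi_apply i)
  have hsq : Integrable (fun z : Fin n → Z => Real.sqrt (∑ i, S (z i))) π := by
    refine ((integrable_const (1 : ℝ)).add hTi).mono' hTm.sqrt.aestronglyMeasurable
      (ae_of_all _ fun z => ?_)
    rw [Real.norm_of_nonneg (Real.sqrt_nonneg _)]
    refine Real.sqrt_le_iff.2 ⟨add_nonneg zero_le_one (hT0 z), ?_⟩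
    simp only [Pi.add_apply]
    nlinarith [hT0 z]
  have hTK : ∫ z, Real.sqrt (∑ i, S (z i)) ∂π ≤ Real.sqrt n * Real.sqrt K := by
    refine (integral_sqrt_le π hTi hT0 hsq).trans ?_
    rw [← Real.sqrt_mul (Nat.cast_nonneg n), integral_finsetSum _ fun i _ =>
      integrable_comp_eval μ hSi i]
    refine Real.sqrt_le_sqrt ?_
    simp only [integral_comp_eval μ hSm]
    simpa using mul_le_mul_of_nonneg_left hSK (Nat.cast_nonneg n)
  have hsi : ∀ ε : Fin n → ℤˣ, Integrable (fun z : Fin n → Z => ⨆ j,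
      |∑ i, ((ε i : ℤ) : ℝ) * (c (z i) * relu (inner ℝ (a (z i)) (x j) + b (z i)))|) π := fun ε =>
    integrable_ciSup_abs (fun j => Finset.measurable_sum _ fun i _ =>
      ((hm j).comp (measurable_pi_apply i)).const_mul _) fun j =>
      integrable_finsetSum _ fun i _ => (integrable_comp_eval μ (hi j) i).const_mul _
  have hsum : 2 ^ n * L ≤ 2 * ∫ z, ∑ ε : Fin n → ℤˣ, ⨆ j,
      |∑ i, ((ε i : ℤ) : ℝ) * (c (z i) * relu (inner ℝ (a (z i)) (x j) + b (z i)))| ∂π := by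
    rw [integral_finsetSum _ fun ε _ => hsi ε, Finset.mul_sum]
    have := Finset.card_nsmul_le_sum (Finset.univ : Finset (Fin n → ℤˣ)) _ L fun ε _ =>
      integral_sup_centered_le μ hm hi ε
    rw [nsmul_eq_mul] at this
    simpa only [Finset.card_univ, Fintype.card_pi, Fintype.card_units_int, Finset.prod_const,
      Fintype.card_fin, Nat.cast_pow, Nat.cast_ofNat] using this
  have hbound : ∫ z, ∑ ε : Fin n → ℤˣ, ⨆ j,
      |∑ i, ((ε i : ℤ) : ℝ) * (c (z i) * relu (inner ℝ (a (z i)) (x j) + b (z i)))| ∂π ≤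
      2 ^ n * (2 * (M + 1)) * (Real.sqrt n * Real.sqrt K) := by
    refine le_trans ?_ (mul_le_mul_of_nonneg_left hTK (by positivity))
    rw [← integral_const_mul]
    refine integral_mono (integrable_finsetSum _ fun ε _ => hsi ε) (hsq.const_mul _) fun z => ?_
    refine (sum_signs_sup_relu_le x hx (fun i => c (z i)) (fun i => b (z i))
      fun i => a (z i)).trans ?_
    have e1 : Real.sqrt (∑ i, (c (z i) * ‖a (z i)‖) ^ 2) ≤ Real.sqrt (∑ i, S (z i)) :=
      Real.sqrt_le_sqrt (Finset.sum_le_sum fun i _ => by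
        simp only [hS]; nlinarith [sq_nonneg (c (z i) * b (z i))])
    have e2 : Real.sqrt (∑ i, (c (z i) * b (z i)) ^ 2) ≤ Real.sqrt (∑ i, S (z i)) :=
      Real.sqrt_le_sqrt (Finset.sum_le_sum fun i _ => by
        simp only [hS]; nlinarith [sq_nonneg (c (z i) * ‖a (z i)‖)])
    have e3 := mul_le_mul_of_nonneg_left e1 hM
    have e4 : (0 : ℝ) ≤ 2 ^ n * 2 := by positivity
    nlinarith [mul_le_mul_of_nonneg_left (add_le_add e3 e2) e4]
  have h2n : (0 : ℝ) < 2 ^ n := by positivity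
  refine le_of_mul_le_mul_left (hsum.trans ((mul_le_mul_of_nonneg_left hbound zero_le_two).trans
    (le_of_eq ?_))) h2n
  ring

/-! ### Fourier inversion for measures with integrable characteristic function -/

section Inversion

lemma norm_cexp_inner_mul_I {W : Type*} [NormedAddCommGroup W] [InnerProductSpace ℝ W] (x y : W) :
    ‖Complex.exp (inner ℝ x y * Complex.I)‖ = 1 :=
  Complex.norm_exp_ofReal_mul_I _

lemma norm_cexp_neg_inner_mul_I {W : Type*} [NormedAddCommGroup W] [InnerProductSpace ℝ W]
    (x y : W) : ‖Complex.exp (-(inner ℝ x y * Complex.I))‖ = 1 := by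
  rw [← neg_mul, ← Complex.ofReal_neg, Complex.norm_exp_ofReal_mul_I]

variable {W : Type*} [NormedAddCommGroup W] [InnerProductSpace ℝ W] [FiniteDimensional ℝ W]
  [MeasurableSpace W] [BorelSpace W]

/-- The Lebesgue density of a measure with integrable characteristic function, as given by the
inversion formula. -/
noncomputable def inversionDensity (m : Measure W) (y : W) : ℂ :=
  ((2 * Real.pi : ℂ) ^ Module.finrank ℝ W)⁻¹ *
    ∫ ξ, charFun m ξ * Complex.exp (-(inner ℝ y ξ * Complex.I))

/-- The Fourier transform of the standard Gaussian function. Only the square of the normalizing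
constant matters, which avoids complex powers. -/
lemma exists_gaussian_fourier (W : Type*) [NormedAddCommGroup W] [InnerProductSpace ℝ W]
    [FiniteDimensional ℝ W] [MeasurableSpace W] [BorelSpace W] :
    ∃ s : ℂ, s * s = (2 * Real.pi : ℂ) ^ Module.finrank ℝ W ∧ s ≠ 0 ∧ ∀ w : W,
      ∫ v : W, (Real.exp (-(1 / 2) * ‖v‖ ^ 2) : ℂ) * Complex.exp (inner ℝ v w * Complex.I) =
        s * Real.exp (-(1 / 2) * ‖w‖ ^ 2) := by
  have h2pi : (2 * Real.pi : ℂ) ≠ 0 := by simp [Real.pi_ne_zero]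
  refine ⟨(2 * Real.pi : ℂ) ^ (Module.finrank ℝ W / 2 : ℂ), ?_, ?_, fun w => ?_⟩
  · rw [← Complex.cpow_add _ _ h2pi, add_halves, Complex.cpow_natCast]
  · simp [Complex.cpow_eq_zero_iff, h2pi]
  · have h := GaussianFourier.integral_cexp_neg_mul_sq_norm_add (V := W) (b := 1 / 2)
      (by norm_num) Complex.I w
    have e : (Real.pi / (1 / 2) : ℂ) = 2 * Real.pi := by ring
    rw [e] at h
    convert h using 2
    · funext v
      rw [Complex.ofReal_exp, ← Complex.exp_add, real_inner_comm]
      push_cast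
      ring_nf
    · rw [Complex.ofReal_exp, Complex.I_sq]
      push_cast
      ring_nf

lemma integrable_gaussian (W : Type*) [NormedAddCommGroup W] [InnerProductSpace ℝ W]
    [FiniteDimensional ℝ W] [MeasurableSpace W] [BorelSpace W] {c : ℝ} (hc : 0 < c) :
    Integrable fun v : W => Real.exp (-c * ‖v‖ ^ 2) := by
  have h := (GaussianFourier.integrable_cexp_neg_mul_sq_norm_add (V := W) (b := (c : ℂ))
      (by simpa using hc) 0 0).re
  refine h.congr (ae_of_all _ fun v => ?_)
  have e : (-(c : ℂ) * ‖v‖ ^ 2 + 0 * (inner ℝ (0 : W) v : ℝ)) = ((-c * ‖v‖ ^ 2 : ℝ) : ℂ) := by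
    push_cast; ring
  simp only [e, ← Complex.ofReal_exp]
  rfl

variable (m : Measure W)

lemma continuous_inversionDensity (hm : Integrable (charFun m)) :
    Continuous (inversionDensity m) := by
  refine continuous_const.mul (continuous_of_dominated (bound := fun ξ => ‖charFun m ξ‖)
    (fun y => ?_) (fun y => ae_of_all _ fun ξ => ?_) hm.norm (ae_of_all _ fun ξ => ?_))
  · exact hm.aestronglyMeasurable.mul (by fun_prop)
  · rw [norm_mul, norm_cexp_neg_inner_mul_I, mul_one]
  · fun_prop

lemma exists_bound_inversionDensity : ∃ K, ∀ y, ‖inversionDensity m y‖ ≤ K := by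
  refine ⟨‖((2 * Real.pi : ℂ) ^ Module.finrank ℝ W)⁻¹‖ * ∫ ξ, ‖charFun m ξ‖, fun y => ?_⟩
  rw [inversionDensity, norm_mul]
  refine mul_le_mul_of_nonneg_left ((norm_integral_le_integral_norm _).trans (le_of_eq ?_))
    (norm_nonneg _)
  simp only [norm_mul, norm_cexp_neg_inner_mul_I, mul_one]

lemma inversionDensity_re (y : W) : ((inversionDensity m y).re : ℂ) = inversionDensity m y := by
  refine Complex.conj_eq_iff_re.1 ?_
  rw [inversionDensity, map_mul, ← integral_conj]
  congr 1
  · rw [map_inv₀, map_pow, map_mul, Complex.conj_ofReal, Complex.conj_ofNat]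
  · rw [← integral_neg_eq_self]
    refine integral_congr_ae (ae_of_all _ fun ξ => ?_)
    simp [charFun_neg, ← Complex.exp_conj, Complex.conj_ofReal]

variable [IsFiniteMeasure m]

/-- Tested against Gaussian wave packets, a finite measure with integrable characteristic function
agrees with the density given by the inversion formula. -/
lemma integral_gaussian_wave (hm : Integrable (charFun m)) (t : W) :
    ∫ v, (Real.exp (-(1 / 2) * ‖v‖ ^ 2) : ℂ) * Complex.exp (inner ℝ v t * Complex.I) ∂m =
      ∫ v, (Real.exp (-(1 / 2) * ‖v‖ ^ 2) : ℂ) * Complex.exp (inner ℝ v t * Complex.I) *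
        inversionDensity m v := by
  obtain ⟨s, hs2, hs0, hs⟩ := exists_gaussian_fourier W
  have hgi : Integrable fun v : W => (Real.exp (-(1 / 2) * ‖v‖ ^ 2) : ℂ) :=
    (integrable_gaussian W (by norm_num : (0 : ℝ) < 1 / 2)).ofReal
  -- Both sides are multiples of the Gaussian smoothing of `charFun m` at `t`: on the left the wave
  -- packet is written as a superposition of waves, on the right its transform is computed.
  have hA : s * ∫ v, (Real.exp (-(1 / 2) * ‖v‖ ^ 2) : ℂ) *
      Complex.exp (inner ℝ v t * Complex.I) ∂m =
      ∫ ξ, (Real.exp (-(1 / 2) * ‖ξ - t‖ ^ 2) : ℂ) * charFun m ξ := by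
    have h1 : ∀ v : W, s * ((Real.exp (-(1 / 2) * ‖v‖ ^ 2) : ℂ) *
        Complex.exp (inner ℝ v t * Complex.I)) =
        ∫ ξ, (Real.exp (-(1 / 2) * ‖ξ - t‖ ^ 2) : ℂ) * Complex.exp (inner ℝ v ξ * Complex.I) := by
      intro v
      rw [← mul_assoc, ← hs v, ← integral_mul_const,
        ← integral_sub_right_eq_self (fun ξ : W => (Real.exp (-(1 / 2) * ‖ξ‖ ^ 2) : ℂ) *
          Complex.exp (inner ℝ ξ v * Complex.I) * Complex.exp (inner ℝ v t * Complex.I)) t]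
      refine integral_congr_ae (ae_of_all _ fun ξ => ?_)
      simp only [mul_assoc, ← Complex.exp_add]
      rw [inner_sub_left, real_inner_comm v t, real_inner_comm v ξ]
      push_cast
      ring_nf
    rw [← integral_const_mul]
    simp only [h1, charFun_apply]
    rw [integral_integral_swap]
    · simp only [integral_const_mul]
    · have hi : Integrable (fun p : W × W => (Real.exp (-(1 / 2) * ‖p.2 - t‖ ^ 2) : ℂ))
          (m.prod volume) := (hgi.comp_sub_right t).comp_snd m
      refine hi.mul_bdd (c := 1) (by fun_prop) (ae_of_all _ fun p => ?_)
      rw [norm_cexp_inner_mul_I]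
  have hB : ∫ v, (Real.exp (-(1 / 2) * ‖v‖ ^ 2) : ℂ) * Complex.exp (inner ℝ v t * Complex.I) *
      ∫ ξ, charFun m ξ * Complex.exp (-(inner ℝ v ξ * Complex.I)) =
      s * ∫ ξ, (Real.exp (-(1 / 2) * ‖ξ - t‖ ^ 2) : ℂ) * charFun m ξ := by
    simp only [← integral_const_mul]
    rw [integral_integral_swap]
    · refine integral_congr_ae (ae_of_all _ fun ξ => ?_)
      have := hs (t - ξ)
      rw [norm_sub_rev] at this
      simp only
      rw [← mul_assoc, ← this, ← integral_mul_const]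
      refine integral_congr_ae (ae_of_all _ fun v => ?_)
      simp only [inner_sub_right]
      rw [Complex.ofReal_sub, sub_mul, sub_eq_add_neg, Complex.exp_add]
      ring
    · have hi : Integrable (fun p : W × W => (Real.exp (-(1 / 2) * ‖p.1‖ ^ 2) : ℂ) *
          charFun m p.2) (volume.prod volume) := hgi.mul_prod hm
      refine (hi.mul_bdd (c := 1) (g := fun p : W × W => Complex.exp (inner ℝ p.1 t * Complex.I) *
        Complex.exp (-(inner ℝ p.1 p.2 * Complex.I))) (by fun_prop)
          (ae_of_all _ fun p => ?_)).congr (ae_of_all _ fun p => ?_)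
      · rw [norm_mul, norm_cexp_inner_mul_I, norm_cexp_neg_inner_mul_I, one_mul]
      · simp only [Function.uncurry]
        ring
  have e : ∀ v, (Real.exp (-(1 / 2) * ‖v‖ ^ 2) : ℂ) * Complex.exp (inner ℝ v t * Complex.I) *
      inversionDensity m v = (s * s)⁻¹ * ((Real.exp (-(1 / 2) * ‖v‖ ^ 2) : ℂ) *
        Complex.exp (inner ℝ v t * Complex.I) *
          ∫ ξ, charFun m ξ * Complex.exp (-(inner ℝ v ξ * Complex.I))) := fun v => by
    rw [hs2, inversionDensity]; ring
  simp only [e]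
  rw [integral_const_mul, hB, ← hA, ← mul_assoc s s, inv_mul_cancel_left₀ (mul_ne_zero hs0 hs0)]

lemma integral_withDensity_ofReal {X G : Type*} [MeasurableSpace X] [NormedAddCommGroup G]
    [NormedSpace ℝ G] {μ : Measure X} {ρ : X → ℝ} (hρ : Measurable ρ) (h0 : ∀ x, 0 ≤ ρ x)
    (f : X → G) : ∫ x, f x ∂(μ.withDensity fun x => ENNReal.ofReal (ρ x)) = ∫ x, ρ x • f x ∂μ := by
  rw [integral_withDensity_eq_integral_toReal_smul hρ.ennreal_ofReal
    (ae_of_all _ fun _ => ENNReal.ofReal_lt_top)]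
  simp only [ENNReal.toReal_ofReal (h0 _)]

/-- Bounded functions of bounded support are integrated by the density given by the inversion
formula. The density is not known to be nonnegative at this stage, so its negative part is moved to
the other side and the uniqueness of characteristic functions is applied to two finite measures
with a Gaussian weight. -/
lemma integral_eq_integral_mul_inversionDensity (hm : Integrable (charFun m)) {F : W → ℝ}
    (hF : Measurable F) {c r : ℝ} (hc : ∀ y, |F y| ≤ c) (hr : ∀ y, r < ‖y‖ → F y = 0) :
    ∫ v, F v ∂m = ∫ y, F y * (inversionDensity m y).re := by
  set γ : W → ℝ := fun v => Real.exp (-(1 / 2) * ‖v‖ ^ 2) with hγ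
  set q : W → ℝ := fun y => (inversionDensity m y).re with hq
  have hγi : Integrable γ := integrable_gaussian W (by norm_num)
  have hγ0 : ∀ v, 0 ≤ γ v := fun v => (Real.exp_pos _).le
  have hγ1 : ∀ v, γ v ≤ 1 := fun v => Real.exp_le_one_iff.2 (by nlinarith [sq_nonneg ‖v‖])
  have hγm : Measurable γ := by fun_prop
  have hγim : Integrable γ m := Integrable.of_bound hγm.aestronglyMeasurable 1
    (ae_of_all _ fun v => by rw [Real.norm_of_nonneg (hγ0 v)]; exact hγ1 v)
  have hqc : Continuous q := Complex.continuous_re.comp (continuous_inversionDensity m hm)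
  obtain ⟨K, hK⟩ := exists_bound_inversionDensity m
  have hqK : ∀ y, |q y| ≤ K := fun y => (Complex.abs_re_le_norm _).trans (hK y)
  set ρ₁ : W → ℝ := fun y => γ y * max (-q y) 0 with hρ₁
  set ρ₂ : W → ℝ := fun y => γ y * max (q y) 0 with hρ₂
  have hρ₁0 : ∀ y, 0 ≤ ρ₁ y := fun y => mul_nonneg (hγ0 y) (le_max_right _ _)
  have hρ₂0 : ∀ y, 0 ≤ ρ₂ y := fun y => mul_nonneg (hγ0 y) (le_max_right _ _)
  have hρ₁m : Measurable ρ₁ := by fun_prop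
  have hρ₂m : Measurable ρ₂ := by fun_prop
  have hρ₁i : Integrable ρ₁ := by
    refine hγi.mul_bdd (c := K) (by fun_prop) (ae_of_all _ fun y => ?_)
    rw [Real.norm_of_nonneg (le_max_right _ _)]
    exact max_le ((neg_le_abs _).trans (hqK y)) ((abs_nonneg _).trans (hqK y))
  have hρ₂i : Integrable ρ₂ := by
    refine hγi.mul_bdd (c := K) (by fun_prop) (ae_of_all _ fun y => ?_)
    rw [Real.norm_of_nonneg (le_max_right _ _)]
    exact max_le ((le_abs_self _).trans (hqK y)) ((abs_nonneg _).trans (hqK y))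
  have hρ : ∀ y, ρ₂ y - ρ₁ y = γ y * q y := fun y => by
    simp only [hρ₁, hρ₂, ← mul_sub]
    congr 1
    rcases le_total (q y) 0 with h | h
    · rw [max_eq_right h, max_eq_left (by linarith)]; ring
    · rw [max_eq_left h, max_eq_right (by linarith)]; ring
  set m₀ := m.withDensity fun x => ENNReal.ofReal (γ x) with hm₀
  set m₁ := (volume : Measure W).withDensity fun x => ENNReal.ofReal (ρ₁ x) with hm₁
  set m₂ := (volume : Measure W).withDensity fun x => ENNReal.ofReal (ρ₂ x) with hm₂
  have : IsFiniteMeasure m₀ := isFiniteMeasure_withDensity_ofReal hγim.2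
  have : IsFiniteMeasure m₁ := isFiniteMeasure_withDensity_ofReal hρ₁i.2
  have : IsFiniteMeasure m₂ := isFiniteMeasure_withDensity_ofReal hρ₂i.2
  have hexp : ∀ (t : W) (μ : Measure W) [IsFiniteMeasure μ],
      Integrable (fun v : W => Complex.exp (inner ℝ v t * Complex.I)) μ := fun t μ _ =>
    Integrable.of_bound (by fun_prop) 1 (ae_of_all _ fun v => (norm_cexp_inner_mul_I v t).le)
  have hsmul : ∀ (t : W) (ρ : W → ℝ), Integrable ρ →
      Integrable fun v => ρ v • Complex.exp (inner ℝ v t * Complex.I) := fun t ρ h => by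
    simp only [Complex.real_smul]
    exact h.ofReal.mul_bdd (c := 1) (by fun_prop)
      (ae_of_all _ fun v => (norm_cexp_inner_mul_I v t).le)
  -- Bounded support makes `F / γ` bounded, so it may be integrated against this identity.
  have heq : m₀ + m₁ = m₂ := by
    refine Measure.ext_of_charFun (funext fun t => ?_)
    rw [charFun_apply, charFun_apply, integral_add_measure (hexp t m₀) (hexp t m₁),
      integral_withDensity_ofReal hγm hγ0, integral_withDensity_ofReal hρ₁m hρ₁0,
      integral_withDensity_ofReal hρ₂m hρ₂0, ← eq_sub_iff_add_eq,
      ← integral_sub (hsmul t ρ₂ hρ₂i) (hsmul t ρ₁ hρ₁i)]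
    simp only [Complex.real_smul]
    rw [integral_gaussian_wave m hm t]
    refine integral_congr_ae (ae_of_all _ fun v => ?_)
    have e : (ρ₂ v : ℂ) - ρ₁ v = γ v * inversionDensity m v := by
      rw [← Complex.ofReal_sub, hρ, Complex.ofReal_mul, inversionDensity_re]
    simp only
    rw [← sub_mul, e]
    ring
  have hγr : ∀ y, ‖y‖ ≤ r → Real.exp (-(1 / 2) * r ^ 2) ≤ γ y := fun y hy =>
    Real.exp_le_exp.2 (by nlinarith [pow_le_pow_left₀ (norm_nonneg y) hy 2])
  have hG : ∀ y, ‖F y / γ y‖ ≤ c / Real.exp (-(1 / 2) * r ^ 2) := by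
    intro y
    have hc0 : 0 ≤ c := (abs_nonneg _).trans (hc y)
    by_cases hy : r < ‖y‖
    · rw [hr y hy]; simp; positivity
    · rw [Real.norm_eq_abs, abs_div, abs_of_nonneg (hγ0 y)]
      exact div_le_div₀ hc0 (hc y) (Real.exp_pos _) (hγr y (not_lt.1 hy))
  have hGi : ∀ (μ : Measure W) [IsFiniteMeasure μ], Integrable (fun y => F y / γ y) μ :=
    fun μ _ => Integrable.of_bound (hF.div hγm).aestronglyMeasurable _ (ae_of_all _ hG)
  have hmul : ∀ (ρ : W → ℝ), Integrable ρ → Integrable fun v => ρ v • (F v / γ v) := fun ρ h =>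
    h.mul_bdd (hF.div hγm).aestronglyMeasurable (ae_of_all _ hG)
  have h := integral_add_measure (hGi m₀) (hGi m₁)
  rw [heq, integral_withDensity_ofReal hγm hγ0, integral_withDensity_ofReal hρ₁m hρ₁0,
      integral_withDensity_ofReal hρ₂m hρ₂0, ← sub_eq_iff_eq_add,
      ← integral_sub (hmul ρ₂ hρ₂i) (hmul ρ₁ hρ₁i)] at h
  simp only [smul_eq_mul] at h
  have hγne : ∀ y, γ y ≠ 0 := fun y => (Real.exp_pos _).ne'
  rw [integral_congr_ae (ae_of_all m fun v => mul_div_cancel₀ (F v) (hγne v))] at h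
  rw [← h]
  refine integral_congr_ae (ae_of_all _ fun y => ?_)
  simp only
  rw [← sub_mul, hρ, mul_right_comm, mul_div_cancel₀ (F y) (hγne y)]

/-- Parseval's identity for a translated function: `x ↦ ∫ F (x + v) dm` is a superposition of the
waves `exp (i ⟨x, ξ⟩)` whose amplitude is the product of the Fourier transform of `F` and the
characteristic function of `m`. -/
lemma integral_translate_eq (hm : Integrable (charFun m)) {F : W → ℝ}
    (hF : Measurable F) {c r : ℝ} (hc : ∀ y, |F y| ≤ c) (hr : ∀ y, r < ‖y‖ → F y = 0)
    (hFi : Integrable F) (x : W) :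
    ((∫ v, F (x + v) ∂m : ℝ) : ℂ) = ∫ ξ, (((2 * Real.pi : ℂ) ^ Module.finrank ℝ W)⁻¹ * charFun m ξ *
      ∫ y, (F y : ℂ) * Complex.exp (-(inner ℝ y ξ * Complex.I))) *
        Complex.exp (inner ℝ x ξ * Complex.I) := by
  rw [integral_eq_integral_mul_inversionDensity m hm (F := fun v => F (x + v))
    (hF.comp (measurable_const_add x))
    (fun y => hc (x + y)) (r := r + ‖x‖) (fun y hy => hr _ (by
      have := norm_sub_le (x + y) x
      rw [add_sub_cancel_left] at this
      linarith)), ← integral_complex_ofReal]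
  have e : ∀ y, ((F (x + y) * (inversionDensity m y).re : ℝ) : ℂ) =
      ∫ ξ, ((2 * Real.pi : ℂ) ^ Module.finrank ℝ W)⁻¹ * charFun m ξ *
        ((F (x + y) : ℂ) * Complex.exp (-(inner ℝ y ξ * Complex.I))) := fun y => by
    rw [Complex.ofReal_mul, inversionDensity_re, inversionDensity, ← integral_const_mul,
      ← integral_const_mul]
    refine integral_congr_ae (ae_of_all _ fun ξ => ?_)
    ring
  simp only [e]
  rw [integral_integral_swap]
  · refine integral_congr_ae (ae_of_all _ fun ξ => ?_)
    simp only
    rw [integral_const_mul, mul_assoc, mul_assoc, mul_assoc]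
    congr 2
    rw [← integral_mul_const, ← integral_add_left_eq_self (fun y => (F y : ℂ) *
      Complex.exp (-(inner ℝ y ξ * Complex.I)) * Complex.exp (inner ℝ x ξ * Complex.I)) x]
    refine integral_congr_ae (ae_of_all _ fun y => ?_)
    simp only [mul_assoc, ← Complex.exp_add]
    rw [inner_add_left]
    push_cast
    ring_nf
  · have hi : Integrable (fun p : W × W => (F (x + p.1) : ℂ) * charFun m p.2)
        (volume.prod volume) := (hFi.comp_add_left x).ofReal.mul_prod hm
    refine ((hi.mul_bdd (c := 1) (g := fun p : W × W =>
      Complex.exp (-(inner ℝ p.1 p.2 * Complex.I))) (by fun_prop)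
        (ae_of_all _ fun p => ?_)).const_mul
        (((2 * Real.pi : ℂ) ^ Module.finrank ℝ W)⁻¹)).congr (ae_of_all _ fun p => ?_)
    · rw [norm_cexp_neg_inner_mul_I]
    · simp only [Function.uncurry]
      ring

end Inversion

/-! ### Importance sampling from the multivariate t-distribution -/

lemma exists_abs_eval_le (p : Polynomial ℝ) :
    ∃ K : ℝ, 0 ≤ K ∧ ∀ b : ℝ, |p.eval b| ≤ K * (1 + |b|) ^ p.natDegree := by
  refine ⟨∑ i ∈ Finset.range (p.natDegree + 1), |p.coeff i|,
    Finset.sum_nonneg fun _ _ => abs_nonneg _, fun b => ?_⟩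
  rw [Polynomial.eval_eq_sum_range, Finset.sum_mul]
  refine (Finset.abs_sum_le_sum_abs _ _).trans (Finset.sum_le_sum fun i hi => ?_)
  rw [abs_mul, abs_pow]
  refine mul_le_mul_of_nonneg_left ?_ (abs_nonneg _)
  calc |b| ^ i ≤ (1 + |b|) ^ i := pow_le_pow_left₀ (abs_nonneg b) (by linarith) i
    _ ≤ (1 + |b|) ^ p.natDegree :=
        pow_le_pow_right₀ (by linarith [abs_nonneg b]) (Nat.lt_succ_iff.1 (Finset.mem_range.1 hi))

/-- Polynomial factors are absorbed by an arbitrarily small part of a Gaussian. -/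
lemma one_add_pow_le_exp_sq {C : ℝ} (hC : 0 < C) (k : ℕ) {r : ℝ} (hr : 0 ≤ r) :
    (1 + r) ^ k ≤ (k.factorial * Real.exp (1 + 1 / (2 * C))) * Real.exp (C / 2 * r ^ 2) := by
  have h1 := Real.pow_div_factorial_le_exp (1 + r) (by linarith) k
  rw [div_le_iff₀ (by positivity)] at h1
  have h2 : 1 + r ≤ 1 + 1 / (2 * C) + C / 2 * r ^ 2 := by
    have e : 1 / (2 * C) + C / 2 * r ^ 2 - r = (C * r - 1) ^ 2 / (2 * C) := by
      field_simp; ring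
    have : 0 ≤ (C * r - 1) ^ 2 / (2 * C) := by positivity
    linarith
  calc (1 + r) ^ k ≤ Real.exp (1 + r) * k.factorial := h1
    _ ≤ Real.exp (1 + 1 / (2 * C) + C / 2 * r ^ 2) * k.factorial := by gcongr
    _ = _ := by rw [Real.exp_add]; ring

/-- The part of the Gamma integral beyond `x` already bounds the integrand at `x`. -/
lemma rpow_mul_exp_neg_le_Gamma {x m : ℝ} (hx : 0 ≤ x) (hm : 0 < m) :
    x ^ m * Real.exp (-x) ≤ Real.Gamma (m + 1) := by
  rw [Real.Gamma_eq_integral (by linarith), add_sub_cancel_right]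
  have hint : IntegrableOn (fun t : ℝ => Real.exp (-t) * t ^ m) (Set.Ioi 0) := by
    simpa using Real.GammaIntegral_convergent (s := m + 1) (by linarith)
  have hsub : Set.Ioi x ⊆ Set.Ioi 0 := Set.Ioi_subset_Ioi hx
  calc x ^ m * Real.exp (-x) = ∫ t in Set.Ioi x, Real.exp (-t) * x ^ m := by
        rw [integral_mul_const, integral_exp_neg_Ioi, mul_comm]
    _ ≤ ∫ t in Set.Ioi x, Real.exp (-t) * t ^ m := by
        refine setIntegral_mono_on ?_ (hint.mono_set hsub) measurableSet_Ioi fun t ht => ?_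
        · exact (integrableOn_exp_neg_Ioi x).mul_const _
        · exact mul_le_mul_of_nonneg_left (Real.rpow_le_rpow hx (le_of_lt ht) hm.le)
            (Real.exp_pos _).le
    _ ≤ ∫ t in Set.Ioi 0, Real.exp (-t) * t ^ m := by
        refine setIntegral_mono_set hint ?_ hsub.eventuallyLE
        filter_upwards [ae_restrict_mem measurableSet_Ioi] with t ht
        exact mul_nonneg (Real.exp_pos _).le (Real.rpow_nonneg (le_of_lt ht) _)

lemma studentTDensity_pos (d : ℕ) {ν : ℝ} (hν : 0 < ν) (x : E d) : 0 < studentTDensity d ν x := by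
  have h1 : 0 < Real.Gamma ((ν + d) / 2) := Real.Gamma_pos_of_pos (by positivity)
  have h2 : 0 < Real.Gamma (ν / 2) := Real.Gamma_pos_of_pos (by positivity)
  have h3 : 0 < 1 + ν⁻¹ * ‖x‖ ^ 2 := by positivity
  have := Real.pi_pos
  rw [studentTDensity]
  positivity

lemma measurable_studentTDensity (d : ℕ) (ν : ℝ) : Measurable (studentTDensity d ν) := by
  unfold studentTDensity
  fun_prop

/-- The tails of the t-distribution are heavy enough for its density to dominate a Gaussian
function, with a constant of exponential rate `(π / c) ^ (d / 2)` in the dimension. -/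
lemma inv_studentTDensity_mul_exp_le (d : ℕ) {ν c : ℝ} (hν : 0 < ν) (hc : 0 < c) (x : E d) :
    (studentTDensity d ν x)⁻¹ * Real.exp (-c * ‖x‖ ^ 2) ≤
      Real.Gamma (ν / 2) * ν ^ (-(ν / 2)) * Real.exp (c * ν) * c ^ (-(ν / 2)) * ((ν + d) / 2) *
        (Real.pi / c) ^ ((d : ℝ) / 2) := by
  set m : ℝ := (ν + d) / 2 with hm
  have hm0 : 0 < m := by positivity
  have hΓm : 0 < Real.Gamma m := Real.Gamma_pos_of_pos hm0
  have hΓ : 0 < Real.Gamma (ν / 2) := Real.Gamma_pos_of_pos (by positivity)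
  set r := ‖x‖ ^ 2 with hr
  have hr0 : 0 ≤ r := by positivity
  have key := rpow_mul_exp_neg_le_Gamma (x := c * (ν + r)) (m := m) (by positivity) hm0
  rw [Real.Gamma_add_one hm0.ne', Real.mul_rpow hc.le (by positivity)] at key
  have e1 : 1 + ν⁻¹ * r = (ν + r) / ν := by field_simp
  have e2 : Real.exp (-(c * (ν + r))) * Real.exp (c * ν) = Real.exp (-c * r) := by
    rw [← Real.exp_add]; ring_nf
  have e3 : c ^ (-(ν / 2)) * (Real.pi / c) ^ ((d : ℝ) / 2) * c ^ m = Real.pi ^ ((d : ℝ) / 2) := by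
    rw [Real.div_rpow Real.pi_pos.le hc.le, hm, add_div, Real.rpow_add hc, Real.rpow_neg hc.le]
    have h1 : c ^ (ν / 2) ≠ 0 := (Real.rpow_pos_of_pos hc _).ne'
    have h2 : c ^ ((d : ℝ) / 2) ≠ 0 := (Real.rpow_pos_of_pos hc _).ne'
    field_simp
  have e4 : ν ^ ((d : ℝ) / 2) * (ν ^ m)⁻¹ = ν ^ (-(ν / 2)) := by
    rw [← Real.rpow_neg hν.le, ← Real.rpow_add hν, hm]; ring_nf
  have e5 : (studentTDensity d ν x)⁻¹ = Real.Gamma (ν / 2) * (ν ^ ((d : ℝ) / 2) * (ν ^ m)⁻¹) *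
      Real.pi ^ ((d : ℝ) / 2) * (ν + r) ^ m / Real.Gamma m := by
    rw [studentTDensity, ← hm, ← hr, e1, Real.rpow_neg (by positivity),
      Real.div_rpow (by positivity) hν.le]
    have h1 : ν ^ m ≠ 0 := (Real.rpow_pos_of_pos hν _).ne'
    have h2 : (ν + r) ^ m ≠ 0 := (Real.rpow_pos_of_pos (by positivity) _).ne'
    have h3 : ν ^ ((d : ℝ) / 2) ≠ 0 := (Real.rpow_pos_of_pos hν _).ne'
    have h4 : Real.pi ^ ((d : ℝ) / 2) ≠ 0 := (Real.rpow_pos_of_pos Real.pi_pos _).ne'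
    field_simp
  rw [e5, e4, ← e3, ← e2]
  have hpos : 0 ≤ Real.Gamma (ν / 2) * ν ^ (-(ν / 2)) * Real.exp (c * ν) *
      (c ^ (-(ν / 2)) * (Real.pi / c) ^ ((d : ℝ) / 2)) := by
    have := Real.pi_pos
    positivity
  have := mul_le_mul_of_nonneg_left ((div_le_iff₀ hΓm).2 key) hpos
  calc _ = _ := ?_
    _ ≤ _ := this
    _ = _ := ?_
  · ring
  · ring

/-- The output weight, as a function of the hidden weights `z = (a, b)`, for which the random
network is an unbiased estimator of the real part of `x ↦ ∫ g ξ * exp (i ⟨ξ, x⟩) dξ` on the ball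
of radius `M`: the coefficient of `relu (⟨a, x⟩ + b)` divided by the density of `(a, b)`. -/
noncomputable def importanceWeight {d : ℕ} (ν M : ℝ) (f : ℝ → ℝ) (g : E d → ℂ) (z : E d × ℝ) : ℝ :=
  (g z.1 * expWeight (M * ‖z.1‖) z.2).re / (studentTDensity d ν z.1 * f z.2)

lemma measurable_importanceWeight {d : ℕ} {ν M : ℝ} {f : ℝ → ℝ} (hf : Measurable f) {g : E d → ℂ}
    (hg : Measurable g) : Measurable (importanceWeight ν M f g) := by
  have h1 : Measurable fun z : E d × ℝ => expWeight (M * ‖z.1‖) z.2 :=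
    measurable_expWeight.comp ((by fun_prop : Measurable fun z : E d × ℝ => M * ‖z.1‖).prodMk
      measurable_snd)
  have h2 := measurable_studentTDensity d ν
  exact (Complex.measurable_re.comp ((hg.comp measurable_fst).mul h1)).div
    ((h2.comp measurable_fst).mul (hf.comp measurable_snd))

/-- Iterated integration against a product of densities, with a bound on the inner integral. -/
lemma lintegral_prod_withDensity_ofReal_le {X Y : Type*} [MeasurableSpace X] [MeasurableSpace Y]
    {μ : Measure X} {κ : Measure Y} [SFinite μ] [SFinite κ] {p : X → ℝ} {q : Y → ℝ}
    (hp : Measurable p) (hq : Measurable q) {F : X × Y → ENNReal} (hF : Measurable F)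
    {B : X → ENNReal} (hB : ∀ x, ∫⁻ y, ENNReal.ofReal (q y) * F (x, y) ∂κ ≤ B x) :
    ∫⁻ z, F z ∂((μ.withDensity fun x => ENNReal.ofReal (p x)).prod
      (κ.withDensity fun y => ENNReal.ofReal (q y))) ≤ ∫⁻ x, ENNReal.ofReal (p x) * B x ∂μ := by
  rw [lintegral_prod _ hF.aemeasurable, lintegral_withDensity_eq_lintegral_mul _ hp.ennreal_ofReal
    hF.lintegral_prod_right']
  refine lintegral_mono fun x => ?_
  simp only [Pi.mul_apply]
  refine mul_le_mul_right ?_ _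
  rw [lintegral_withDensity_eq_lintegral_mul _ hq.ennreal_ofReal (g := fun y => F (x, y))
    (hF.comp measurable_prodMk_left)]
  exact hB x

/-- The second moment of the weighted features at a fixed inner weight: the reciprocal of the bias
density and the length of the support of the biases contribute a polynomial in `‖a‖`. -/
lemma lintegral_importanceWeight_bias_le {f : ℝ → ℝ} {K₀ M ν : ℝ} {n d : ℕ} (hK₀ : 0 ≤ K₀)
    (hM : 0 ≤ M) (hν : 0 < ν) (hpos : ∀ b, 0 < f b) (hinv : ∀ b, (f b)⁻¹ ≤ K₀ * (1 + |b|) ^ n)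
    (g : E d → ℂ) (a : E d) :
    ∫⁻ b, ENNReal.ofReal (f b) *
        ENNReal.ofReal (importanceWeight ν M f g (a, b) ^ 2 * (‖a‖ ^ 2 + b ^ 2)) ≤
      ENNReal.ofReal ((‖g a‖ / studentTDensity d ν a) ^ 2 *
        (484 * K₀ * (M + 2) ^ (n + 3) * (1 + ‖a‖) ^ (n + 3))) := by
  set r := ‖a‖ with hr
  have hr0 : 0 ≤ r := norm_nonneg _
  set L := M * r with hL
  have hL0 : 0 ≤ L := by positivity
  set q := studentTDensity d ν a with hq
  have hq0 : 0 < q := studentTDensity_pos d hν a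
  set T := (11 * (‖g a‖ / q)) ^ 2 * (K₀ * (L + 2) ^ n) * (r ^ 2 + (L + 1) ^ 2) with hT
  have hT0 : 0 ≤ T := by positivity
  have hpt : ∀ b, ENNReal.ofReal (f b) *
        ENNReal.ofReal (importanceWeight ν M f g (a, b) ^ 2 * (r ^ 2 + b ^ 2)) ≤
      (Set.Icc (-(L + 1)) (L + 1)).indicator (fun _ => ENNReal.ofReal T) b := by
    intro b
    by_cases hb : b ∈ Set.Icc (-(L + 1)) (L + 1)
    · rw [Set.indicator_of_mem hb, ← ENNReal.ofReal_mul (hpos b).le]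
      refine ENNReal.ofReal_le_ofReal ?_
      have hb' : |b| ≤ L + 1 := abs_le.2 hb
      have hw : |(g a * expWeight L b).re| ≤ 11 * ‖g a‖ := by
        refine (Complex.abs_re_le_norm _).trans ?_
        rw [norm_mul, mul_comm]
        exact mul_le_mul_of_nonneg_right (norm_expWeight_le L b) (norm_nonneg _)
      have hw2 : (g a * expWeight L b).re ^ 2 ≤ (11 * ‖g a‖) ^ 2 :=
        sq_le_sq' (abs_le.1 hw).1 (abs_le.1 hw).2
      have e : f b * (importanceWeight ν M f g (a, b) ^ 2 * (r ^ 2 + b ^ 2)) =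
          ((g a * expWeight L b).re ^ 2 / q ^ 2) * (f b)⁻¹ * (r ^ 2 + b ^ 2) := by
        have := (hpos b).ne'
        simp only [importanceWeight, ← hq, ← hr, ← hL]
        field_simp
      rw [e, hT, mul_pow, div_pow, ← mul_div_assoc, ← mul_pow]
      have hinv' : (f b)⁻¹ ≤ K₀ * (L + 2) ^ n := (hinv b).trans
        (mul_le_mul_of_nonneg_left (pow_le_pow_left₀ (by positivity) (by linarith) n) hK₀)
      have hb2 : b ^ 2 ≤ (L + 1) ^ 2 := sq_le_sq' (abs_le.1 hb').1 (abs_le.1 hb').2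
      have := (inv_pos.2 (hpos b)).le
      gcongr
    · rw [Set.indicator_of_notMem hb]
      have hb' : L + 1 < |b| := by
        by_contra h
        exact hb (abs_le.1 (not_lt.1 h))
      simp [importanceWeight, ← hr, ← hL, expWeight_eq_zero hL0 hb']
  refine (lintegral_mono hpt).trans ?_
  rw [lintegral_indicator measurableSet_Icc, setLIntegral_const, Real.volume_Icc,
    ← ENNReal.ofReal_mul hT0]
  refine ENNReal.ofReal_le_ofReal ?_
  have h1 : L + 2 ≤ (M + 2) * (1 + r) := by rw [hL]; nlinarith
  have h2 : L + 1 - -(L + 1) ≤ 2 * ((M + 2) * (1 + r)) := by linarith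
  have h3 : r ^ 2 + (L + 1) ^ 2 ≤ 2 * ((M + 2) * (1 + r)) ^ 2 := by
    have h4 : r ≤ (M + 2) * (1 + r) := by nlinarith
    have h5 := pow_le_pow_left₀ hr0 h4 2
    have h6 := pow_le_pow_left₀ (by linarith : 0 ≤ L + 1)
      (by linarith : L + 1 ≤ (M + 2) * (1 + r)) 2
    linarith
  calc T * (L + 1 - -(L + 1))
      ≤ ((11 * (‖g a‖ / q)) ^ 2 * (K₀ * ((M + 2) * (1 + r)) ^ n) *
        (2 * ((M + 2) * (1 + r)) ^ 2)) * (2 * ((M + 2) * (1 + r))) := by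
        rw [hT]
        gcongr
        linarith
    _ = (‖g a‖ / q) ^ 2 * (484 * K₀ * (M + 2) ^ (n + 3) * (1 + r) ^ (n + 3)) := by
        rw [mul_pow (M + 2) (1 + r) n]
        ring

/-- The second moment of the weighted features grows only linearly in the dimension: the factors
exponential in `d` combine to `(4 π · 3 C / 4) ^ (-d) ≤ 1`. -/
lemma exists_lintegral_importanceWeight_le {f : ℝ → ℝ} (hf : Measurable f)
    (hdecay : AtMostPolynomialDecay f) {ν C M : ℝ} (hν : 0 < ν) (hC : 0 < C)
    (hC2 : 1 / (8 * Real.pi ^ 2) < C ^ 2) (hM : 0 ≤ M) :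
    ∃ K : ℝ, 0 < K ∧ ∀ (d : ℕ) (g : E d → ℂ) (I : ℝ), Measurable g →
      (∀ ξ, ‖g ξ‖ ≤ ((2 * Real.pi) ^ d)⁻¹ * I * Real.exp (-C * ‖ξ‖ ^ 2)) →
      ∫⁻ z, ENNReal.ofReal (importanceWeight ν M f g z ^ 2 * (‖z.1‖ ^ 2 + z.2 ^ 2))
        ∂((studentT d ν).prod (volume.withDensity fun b => ENNReal.ofReal (f b))) ≤
      ENNReal.ofReal (K * I ^ 2 * (ν + d)) := by
  obtain ⟨p, hp⟩ := hdecay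
  obtain ⟨K₀, hK₀, hpK⟩ := exists_abs_eval_le p
  set n := p.natDegree
  have hpos : ∀ b, 0 < f b := fun b => by
    by_contra h
    nlinarith [hp b, mul_nonneg (hp b).1.le (neg_nonneg.2 (not_lt.1 h))]
  have hinv : ∀ b, (f b)⁻¹ ≤ K₀ * (1 + |b|) ^ n := fun b => by
    refine le_trans ?_ ((le_abs_self _).trans (hpK b))
    rw [inv_le_iff_one_le_mul₀ (hpos b)]
    exact (hp b).2
  have hpi := Real.pi_pos
  -- Of the factor `exp (-2 C ‖a‖ ^ 2)` a quarter absorbs the polynomial factors; of the rest, one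
  -- half bounds the reciprocal of the t-density and the other half keeps the integral finite.
  set c := 3 * C / 4 with hc
  have hc0 : 0 < c := by positivity
  have h4pc : 1 ≤ 4 * Real.pi * c := by
    rw [div_lt_iff₀ (by positivity)] at hC2
    rw [← one_le_sq_iff₀ (by positivity), hc]
    nlinarith
  set K₂ := 484 * K₀ * (M + 2) ^ (n + 3) *
    ((n + 3).factorial * Real.exp (1 + 1 / (2 * C))) with hK₂
  have hK₂0 : 0 ≤ K₂ := by positivity
  set Q := Real.Gamma (ν / 2) * ν ^ (-(ν / 2)) * Real.exp (c * ν) * c ^ (-(ν / 2)) / 2 with hQ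
  have hQ0 : 0 < Q := by
    have : 0 < Real.Gamma (ν / 2) := Real.Gamma_pos_of_pos (by positivity)
    positivity
  refine ⟨K₂ * Q + 1, by positivity, fun d g I hg hgI => ?_⟩
  have hFm : Measurable fun z : E d × ℝ =>
      ENNReal.ofReal (importanceWeight ν M f g z ^ 2 * (‖z.1‖ ^ 2 + z.2 ^ 2)) := by
    have := measurable_importanceWeight (ν := ν) (M := M) hf hg
    fun_prop
  refine (lintegral_prod_withDensity_ofReal_le (measurable_studentTDensity d ν) hf hFm
    (fun a => lintegral_importanceWeight_bias_le hK₀ hM hν hpos hinv g a)).trans ?_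
  set D := ((2 * Real.pi) ^ d)⁻¹ * I with hD
  set S := D ^ 2 * K₂ * (Q * (ν + d) * (Real.pi / c) ^ ((d : ℝ) / 2)) with hS
  have hS0 : 0 ≤ S := by positivity
  have hpt : ∀ a : E d, ENNReal.ofReal (studentTDensity d ν a) *
      ENNReal.ofReal ((‖g a‖ / studentTDensity d ν a) ^ 2 *
        (484 * K₀ * (M + 2) ^ (n + 3) * (1 + ‖a‖) ^ (n + 3))) ≤
      ENNReal.ofReal (S * Real.exp (-c * ‖a‖ ^ 2)) := by
    intro a
    have hq0 := studentTDensity_pos d hν a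
    rw [← ENNReal.ofReal_mul hq0.le]
    refine ENNReal.ofReal_le_ofReal ?_
    have h1 := one_add_pow_le_exp_sq hC (n + 3) (norm_nonneg a)
    have h2 := inv_studentTDensity_mul_exp_le d hν hc0 a
    have h3 : ‖g a‖ ^ 2 ≤ D ^ 2 * Real.exp (-C * ‖a‖ ^ 2) ^ 2 := by
      rw [← mul_pow]
      exact pow_le_pow_left₀ (norm_nonneg _) (hgI a) 2
    have e1 : Real.exp (-C * ‖a‖ ^ 2) ^ 2 * Real.exp (C / 2 * ‖a‖ ^ 2) =
        Real.exp (-c * ‖a‖ ^ 2) * Real.exp (-c * ‖a‖ ^ 2) := by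
      rw [← Real.exp_nat_mul, ← Real.exp_add, ← Real.exp_add, hc]
      push_cast
      ring_nf
    calc studentTDensity d ν a * ((‖g a‖ / studentTDensity d ν a) ^ 2 *
          (484 * K₀ * (M + 2) ^ (n + 3) * (1 + ‖a‖) ^ (n + 3)))
        = ‖g a‖ ^ 2 * (484 * K₀ * (M + 2) ^ (n + 3) * (1 + ‖a‖) ^ (n + 3)) *
            (studentTDensity d ν a)⁻¹ := by
          field_simp
      _ ≤ (D ^ 2 * Real.exp (-C * ‖a‖ ^ 2) ^ 2) * (484 * K₀ * (M + 2) ^ (n + 3) *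
            (((n + 3).factorial * Real.exp (1 + 1 / (2 * C))) * Real.exp (C / 2 * ‖a‖ ^ 2))) *
            (studentTDensity d ν a)⁻¹ := by
          gcongr
      _ = D ^ 2 * K₂ * (Real.exp (-C * ‖a‖ ^ 2) ^ 2 * Real.exp (C / 2 * ‖a‖ ^ 2)) *
            (studentTDensity d ν a)⁻¹ := by
          rw [hK₂]; ring
      _ = D ^ 2 * K₂ * ((studentTDensity d ν a)⁻¹ * Real.exp (-c * ‖a‖ ^ 2)) *
            Real.exp (-c * ‖a‖ ^ 2) := by
          rw [e1]; ring
      _ ≤ D ^ 2 * K₂ * (Real.Gamma (ν / 2) * ν ^ (-(ν / 2)) * Real.exp (c * ν) * c ^ (-(ν / 2)) *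
            ((ν + d) / 2) * (Real.pi / c) ^ ((d : ℝ) / 2)) * Real.exp (-c * ‖a‖ ^ 2) := by
          gcongr
      _ = S * Real.exp (-c * ‖a‖ ^ 2) := by
          rw [hS, hQ]; ring
  refine (lintegral_mono hpt).trans ?_
  rw [← ofReal_integral_eq_lintegral_ofReal ((integrable_gaussian (E d) hc0).const_mul S)
    (ae_of_all _ fun a => by positivity), integral_const_mul,
    GaussianFourier.integral_rexp_neg_mul_sq_norm hc0]
  refine ENNReal.ofReal_le_ofReal ?_
  have e2 : (Real.pi / c) ^ ((d : ℝ) / 2) * (Real.pi / c) ^ ((d : ℝ) / 2) = (Real.pi / c) ^ d := by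
    rw [← Real.rpow_add (by positivity), add_halves, Real.rpow_natCast]
  have e3 : (((2 * Real.pi) ^ d)⁻¹) ^ 2 * (Real.pi / c) ^ d = ((4 * Real.pi * c) ^ d)⁻¹ := by
    rw [← inv_pow, ← pow_mul, mul_comm d 2, pow_mul, ← mul_pow, ← inv_pow]
    congr 1
    field_simp
    ring
  have e4 : ((4 * Real.pi * c) ^ d)⁻¹ ≤ 1 := inv_le_one_of_one_le₀ (one_le_pow₀ h4pc)
  rw [finrank_euclideanSpace_fin]
  calc S * (Real.pi / c) ^ ((d : ℝ) / 2)
      = I ^ 2 * K₂ * (Q * (ν + d)) * ((((2 * Real.pi) ^ d)⁻¹) ^ 2 *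
          ((Real.pi / c) ^ ((d : ℝ) / 2) * (Real.pi / c) ^ ((d : ℝ) / 2))) := by
        rw [hS, hD]; ring
    _ = I ^ 2 * K₂ * (Q * (ν + d)) * ((4 * Real.pi * c) ^ d)⁻¹ := by rw [e2, e3]
    _ ≤ I ^ 2 * K₂ * (Q * (ν + d)) * 1 := by gcongr
    _ = (K₂ * Q) * I ^ 2 * (ν + d) := by ring
    _ ≤ (K₂ * Q + 1) * I ^ 2 * (ν + d) := by gcongr; linarith

instance (d : ℕ) (ν : ℝ) : SFinite (studentT d ν) := by
  unfold studentT
  infer_instance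

/-- The importance weights make the ReLU features unbiased. -/
lemma integral_importanceWeight_mul_relu {d : ℕ} {f : ℝ → ℝ} (hf : Measurable f)
    (hpos : ∀ b, 0 < f b) {ν M : ℝ} (hν : 0 < ν) {g : E d → ℂ} (hg : Integrable g) {x : E d}
    (hx : ‖x‖ ≤ M)
    (hi : Integrable (fun z : E d × ℝ => importanceWeight ν M f g z * relu (inner ℝ z.1 x + z.2))
      ((studentT d ν).prod (volume.withDensity fun b => ENNReal.ofReal (f b)))) :
    ∫ z, importanceWeight ν M f g z * relu (inner ℝ z.1 x + z.2)
        ∂((studentT d ν).prod (volume.withDensity fun b => ENNReal.ofReal (f b))) =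
      (∫ ξ, g ξ * Complex.exp (inner ℝ x ξ * Complex.I)).re := by
  have hge : Integrable fun ξ => g ξ * Complex.exp (inner ℝ x ξ * Complex.I) :=
    hg.mul_bdd (c := 1) (by fun_prop) (ae_of_all _ fun ξ => (norm_cexp_inner_mul_I x ξ).le)
  rw [integral_prod _ hi]
  rw [studentT, integral_withDensity_ofReal (measurable_studentTDensity d ν)
    fun a => (studentTDensity_pos d hν a).le]
  have hre : (∫ ξ, g ξ * Complex.exp (inner ℝ x ξ * Complex.I)).re =
      ∫ ξ, (g ξ * Complex.exp (inner ℝ x ξ * Complex.I)).re := (integral_re hge).symm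
  rw [hre]
  refine integral_congr_ae (ae_of_all _ fun a => ?_)
  simp only
  rw [integral_withDensity_ofReal hf fun b => (hpos b).le]
  have hq := (studentTDensity_pos d hν a).ne'
  have hu : |inner ℝ a x| ≤ M * ‖a‖ := by
    rw [mul_comm]
    exact (abs_real_inner_le_norm _ _).trans (mul_le_mul_of_nonneg_left hx (norm_nonneg _))
  have e1 : ∀ b, f b • (importanceWeight ν M f g (a, b) * relu (inner ℝ a x + b)) =
      (studentTDensity d ν a)⁻¹ *
        (g a * (expWeight (M * ‖a‖) b * (relu (inner ℝ a x + b) : ℂ))).re := by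
    intro b
    have := (hpos b).ne'
    rw [← mul_assoc (g a), Complex.re_mul_ofReal, importanceWeight, smul_eq_mul]
    field_simp
  simp only [e1]
  have e2 : ∫ b, (g a * (expWeight (M * ‖a‖) b * (relu (inner ℝ a x + b) : ℂ))).re =
      (∫ b, g a * (expWeight (M * ‖a‖) b * (relu (inner ℝ a x + b) : ℂ))).re :=
    integral_re ((integrable_expWeight_mul_relu _ _).const_mul _)
  rw [integral_const_mul, smul_eq_mul, mul_inv_cancel_left₀ hq, e2, integral_const_mul,
    integral_expWeight_mul_relu hu, real_inner_comm, mul_comm Complex.I]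

/-! ### The uniform error of the network -/

/-- For a continuous function the supremum over a ball is a countable one, hence measurable in
parameters. -/
lemma iSup_closedBall_eq_iSup_denseSeq {F : Type*} [NormedAddCommGroup F]
    [SecondCountableTopology F] {M : ℝ} [Nonempty (Metric.closedBall (0 : F) M)] {f : F → ℝ}
    (hf : ContinuousOn f (Metric.closedBall 0 M)) :
    ⨆ x ∈ Metric.closedBall (0 : F) M, ENNReal.ofReal |f x| =
      ⨆ n, ENNReal.ofReal |f (TopologicalSpace.denseSeq (Metric.closedBall (0 : F) M) n)| := by
  refine le_antisymm (iSup₂_le fun x hx => ?_) (iSup_le fun n =>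
    le_iSup₂_of_le (f := fun x _ => ENNReal.ofReal |f x|) _
      (TopologicalSpace.denseSeq (Metric.closedBall (0 : F) M) n).2 le_rfl)
  set s := ⨆ n, ENNReal.ofReal |f (TopologicalSpace.denseSeq (Metric.closedBall (0 : F) M) n)|
  have hc : Continuous fun y : Metric.closedBall (0 : F) M => ENNReal.ofReal |f y| :=
    ENNReal.continuous_ofReal.comp (continuousOn_iff_continuous_domRestrict.1 hf).abs
  have hcl : IsClosed {y : Metric.closedBall (0 : F) M | ENNReal.ofReal |f y| ≤ s} :=
    isClosed_le hc continuous_const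
  have hsub : Set.range (TopologicalSpace.denseSeq (Metric.closedBall (0 : F) M)) ⊆
      {y : Metric.closedBall (0 : F) M | ENNReal.ofReal |f y| ≤ s} := by
    rintro _ ⟨n, rfl⟩
    exact le_iSup (fun n =>
      ENNReal.ofReal |f (TopologicalSpace.denseSeq (Metric.closedBall (0 : F) M) n)|) n
  exact hcl.closure_subset_iff.2 hsub
    (TopologicalSpace.denseRange_denseSeq _ (⟨x, hx⟩ : Metric.closedBall (0 : F) M))

lemma continuous_network {d N : ℕ} (a : Fin N → E d) (b : Fin N → ℝ) (w : E N) :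
    Continuous (network a b w) :=
  continuous_finsetSum _ fun _ _ => continuous_const.mul
    (continuous_relu.comp ((continuous_const.inner continuous_id).add continuous_const))

/-- The joint law of the pairs `(A i, B i)`. -/
lemma IsHiddenWeights.measurePreserving {Ω : Type*} [MeasurableSpace Ω] {P : Measure Ω}
    [IsProbabilityMeasure P] {d N : ℕ} {ν : ℝ} {f : ℝ → ℝ} {A : Fin N → Ω → E d}
    {B : Fin N → Ω → ℝ} (h : IsHiddenWeights P ν f A B) [SigmaFinite (studentT d ν)]
    [SigmaFinite (volume.withDensity fun b => ENNReal.ofReal (f b))] :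
    MeasurePreserving (fun ω i => (A i ω, B i ω)) P (Measure.pi fun _ => (studentT d ν).prod
      (volume.withDensity fun b => ENNReal.ofReal (f b))) := by
  have hA : Measurable fun ω i => A i ω := measurable_pi_lambda _ h.measurable_A
  have hB : Measurable fun ω i => B i ω := measurable_pi_lambda _ h.measurable_B
  have h1 := (iIndepFun_iff_map_fun_eq_pi_map fun i => (h.measurable_A i).aemeasurable).1 h.iIndep_A
  have h2 := (iIndepFun_iff_map_fun_eq_pi_map fun i => (h.measurable_B i).aemeasurable).1 h.iIndep_B
  have h3 := (indepFun_iff_map_prod_eq_prod_map_map hA.aemeasurable hB.aemeasurable).1 h.indep_AB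
  simp only [h.law_A, h.law_B] at h1 h2
  rw [h1, h2] at h3
  have h4 : MeasurePreserving (fun ω => ((fun i => A i ω, fun i => B i ω) : (Fin N → E d) × _)) P
      _ := ⟨hA.prodMk hB, h3⟩
  exact ((measurePreserving_arrowProdEquivProdArrow (E d) ℝ (Fin N) _ _).symm _).comp h4

/-- The expected uniform error, over a sequence of points of a ball, of the network with
weights `c (A i, B i) / N`. -/
lemma lintegral_iSup_network_sub_le {Ω : Type*} [MeasurableSpace Ω] {P : Measure Ω}
    [IsProbabilityMeasure P] {d N : ℕ} (hN : 0 < N) {ν : ℝ} {f : ℝ → ℝ} {A : Fin N → Ω → E d}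
    {B : Fin N → Ω → ℝ} (h : IsHiddenWeights P ν f A B) [IsProbabilityMeasure (studentT d ν)]
    [IsProbabilityMeasure (volume.withDensity fun b => ENNReal.ofReal (f b))]
    {c : E d × ℝ → ℝ} (hc : Measurable c) {K M : ℝ} (hK : 0 ≤ K) (hM : 0 ≤ M)
    (hL : ∫⁻ z, ENNReal.ofReal (c z ^ 2 * (‖z.1‖ ^ 2 + z.2 ^ 2)) ∂((studentT d ν).prod
      (volume.withDensity fun b => ENNReal.ofReal (f b))) ≤ ENNReal.ofReal K)
    (x : ℕ → E d) (hx : ∀ n, ‖x n‖ ≤ M) :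
    ∫⁻ ω, ⨆ n, ENNReal.ofReal |network (fun i => A i ω) (fun i => B i ω)
        (WithLp.toLp 2 fun i => c (A i ω, B i ω) / N) (x n) -
        ∫ z, c z * relu (inner ℝ z.1 (x n) + z.2) ∂((studentT d ν).prod
          (volume.withDensity fun b => ENNReal.ofReal (f b)))| ∂P ≤
      ENNReal.ofReal (4 * (M + 1) * Real.sqrt K / Real.sqrt N) := by
  set μ := (studentT d ν).prod (volume.withDensity fun b => ENNReal.ofReal (f b)) with hμ
  have hN' : (0 : ℝ) < N := Nat.cast_pos.2 hN
  set D : ℕ → (Fin N → E d × ℝ) → ℝ := fun n z =>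
    ∑ i, (c (z i) * relu (inner ℝ (z i).1 (x n) + (z i).2) -
      ∫ y, c y * relu (inner ℝ y.1 (x n) + y.2) ∂μ) with hD
  have hDm : ∀ n, Measurable (D n) := fun n => Finset.measurable_sum _ fun i _ => by
    have hz : Measurable fun z : Fin N → E d × ℝ => z i := measurable_pi_apply i
    exact ((hc.comp hz).mul (((hz.fst.inner measurable_const).add hz.snd).max
      measurable_const)).sub measurable_const
  have hmp := h.measurePreserving
  rw [← hμ] at hmp
  have e1 : ∀ ω n, |network (fun i => A i ω) (fun i => B i ω)
        (WithLp.toLp 2 fun i => c (A i ω, B i ω) / N) (x n) -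
        ∫ z, c z * relu (inner ℝ z.1 (x n) + z.2) ∂μ| =
      (N : ℝ)⁻¹ * |D n fun i => (A i ω, B i ω)| := by
    intro ω n
    nth_rewrite 1 [← abs_of_pos (inv_pos.2 hN')]
    rw [← abs_mul]
    congr 1
    simp only [hD, network, Finset.sum_sub_distrib, Finset.sum_const, Finset.card_univ,
      Fintype.card_fin, nsmul_eq_mul, mul_sub, inv_mul_cancel_left₀ hN'.ne', Finset.mul_sum]
    congr 1
    exact Finset.sum_congr rfl fun i _ => by ring
  simp only [e1]
  rw [hmp.lintegral_comp (f := fun z => ⨆ n, ENNReal.ofReal ((N : ℝ)⁻¹ * |D n z|))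
    (Measurable.iSup fun n => ((hDm n).abs.const_mul _).ennreal_ofReal)]
  -- Partial suprema over finitely many points increase to the full one.
  have e2 : ∀ z, ⨆ n, ENNReal.ofReal ((N : ℝ)⁻¹ * |D n z|) =
      ⨆ n : ℕ, ENNReal.ofReal ((N : ℝ)⁻¹ * ⨆ j : Fin (n + 1), |D j z|) := by
    intro z
    refine le_antisymm (iSup_le fun n => le_iSup_of_le n ?_) (iSup_le fun n => ?_)
    · exact ENNReal.ofReal_le_ofReal (mul_le_mul_of_nonneg_left
        (le_ciSup_of_fintype (fun j : Fin (n + 1) => |D j z|) (Fin.last n)) (inv_pos.2 hN').le)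
    · obtain ⟨j, hj⟩ := exists_eq_ciSup_of_finite (f := fun j : Fin (n + 1) => |D j z|)
      rw [← hj]
      exact le_iSup (fun n => ENNReal.ofReal ((N : ℝ)⁻¹ * |D n z|)) j
  simp only [e2]
  rw [lintegral_iSup]
  · refine iSup_le fun n => ?_
    have hi : ∀ j : Fin (n + 1), Integrable (D j) (Measure.pi fun _ : Fin N => μ) := fun j =>
      integrable_finsetSum _ fun i _ => (integrable_comp_eval μ
        (integrable_mul_relu hc measurable_snd measurable_fst hL (hx j)) i).sub (integrable_const _)
    have hsi := integrable_ciSup_abs (fun j : Fin (n + 1) => hDm j) hi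
    rw [← ofReal_integral_eq_lintegral_ofReal (hsi.const_mul _) (ae_of_all _ fun z =>
      mul_nonneg (inv_pos.2 hN').le (ciSup_abs_nonneg _)), integral_const_mul]
    refine ENNReal.ofReal_le_ofReal ?_
    have key := integral_sup_relu_centered_le μ hc measurable_snd measurable_fst hK hM hL
      (fun j : Fin (n + 1) => x j) (fun j => hx j) N
    refine (mul_le_mul_of_nonneg_left key (inv_pos.2 hN').le).trans (le_of_eq ?_)
    have hs : Real.sqrt N * Real.sqrt N = N := Real.mul_self_sqrt hN'.le
    have hs0 : Real.sqrt N ≠ 0 := (Real.sqrt_pos.2 hN').ne'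
    nth_rewrite 1 [← hs]
    field_simp
  · exact fun n => ((measurable_ciSup_abs fun j : Fin (n + 1) => hDm j).const_mul _).ennreal_ofReal
  · intro n k hnk z
    refine ENNReal.ofReal_le_ofReal (mul_le_mul_of_nonneg_left (ciSup_le fun j => ?_)
      (inv_pos.2 hN').le)
    exact le_ciSup_of_fintype (fun j : Fin (k + 1) => |D j z|)
      (Fin.castLE (Nat.succ_le_succ hnk) j)

/-! ### Truncation of the smoothed function -/

section Truncation

variable {d : ℕ} {ψ : E d → E d} {Φ : E d → ℝ} {CLip M : ℝ}

/-- `Φ` is a Lipschitz function of `ψ`, although neither `Φ` nor `ψ` need be continuous. -/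
lemma measurable_of_abs_sub_le (hψ : Measurable ψ) (hC : 0 ≤ CLip)
    (hΦ : ∀ x y, |Φ x - Φ y| ≤ CLip * ‖ψ x - ψ y‖) : Measurable Φ := by
  have hinv : ∀ x, ψ (Function.invFun ψ (ψ x)) = ψ x := fun x => Function.invFun_eq ⟨x, rfl⟩
  have hlip : LipschitzOnWith ⟨CLip, hC⟩ (fun z => Φ (Function.invFun ψ z)) (Set.range ψ) := by
    refine LipschitzOnWith.of_dist_le_mul ?_
    rintro _ ⟨x, rfl⟩ _ ⟨y, rfl⟩
    rw [Real.dist_eq, dist_eq_norm]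
    refine (hΦ _ _).trans ?_
    rw [hinv, hinv]
    rfl
  obtain ⟨G, hG, hGe⟩ := hlip.extend_real
  have e : Φ = fun x => G (ψ x) := by
    funext x
    rw [← hGe ⟨x, rfl⟩]
    have := hΦ x (Function.invFun ψ (ψ x))
    rw [hinv, sub_self, norm_zero, mul_zero] at this
    exact sub_eq_zero.1 (abs_nonpos_iff.1 this)
  rw [e]
  exact hG.continuous.measurable.comp hψ

lemma norm_le_of_increasing (hmono : Increasing ψ) (h0 : ∀ x i, 0 ≤ ψ x i) {x y : E d}
    (hxy : ∀ i, x i ≤ y i) : ‖ψ x‖ ≤ ‖ψ y‖ := by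
  rw [EuclideanSpace.norm_eq, EuclideanSpace.norm_eq]
  refine Real.sqrt_le_sqrt (Finset.sum_le_sum fun i _ => ?_)
  rw [Real.norm_of_nonneg (h0 x i), Real.norm_of_nonneg (h0 y i)]
  exact pow_le_pow_left₀ (h0 x i) (hmono x y hxy i) 2

lemma abs_add_le_of_increasing (hmono : Increasing ψ) (h0 : ∀ x i, 0 ≤ ψ x i) (hC : 0 ≤ CLip)
    (hΦ : ∀ x y, |Φ x - Φ y| ≤ CLip * ‖ψ x - ψ y‖) {x : E d} (hx : ‖x‖ ≤ M) (v : E d) :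
    |Φ (x + v)| ≤ |Φ 0| + CLip * (‖ψ (constVec d M + v)‖ + ‖ψ 0‖) := by
  have h1 : ‖ψ (x + v)‖ ≤ ‖ψ (constVec d M + v)‖ := norm_le_of_increasing hmono h0 fun i => by
    have := (le_abs_self _).trans ((PiLp.norm_apply_le x i).trans hx)
    simp only [PiLp.add_apply, constVec]
    linarith
  have h2 := (hΦ (x + v) 0).trans (mul_le_mul_of_nonneg_left (norm_sub_le _ _) hC)
  have h3 := abs_sub_abs_le_abs_sub (Φ (x + v)) (Φ 0)
  have h4 := mul_le_mul_of_nonneg_left h1 hC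
  linarith

/-- `Φ` is bounded on balls, since `ψ` is monotone and finite at the corner of a cube containing
the ball. -/
lemma exists_abs_le_of_increasing (hmono : Increasing ψ) (h0 : ∀ x i, 0 ≤ ψ x i) (hC : 0 ≤ CLip)
    (hΦ : ∀ x y, |Φ x - Φ y| ≤ CLip * ‖ψ x - ψ y‖) (r : ℝ) :
    ∃ c, 0 ≤ c ∧ ∀ y, ‖y‖ ≤ r → |Φ y| ≤ c :=
  ⟨|Φ 0| + CLip * (‖ψ (constVec d r + 0)‖ + ‖ψ 0‖), by positivity, fun y hy => by
    simpa using abs_add_le_of_increasing hmono h0 hC hΦ hy 0⟩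

variable {Ω : Type*} [MeasurableSpace Ω] {P : Measure Ω} [IsProbabilityMeasure P] {V : Ω → E d}

lemma integrable_add_of_increasing (hψ : Measurable ψ) (hmono : Increasing ψ)
    (h0 : ∀ x i, 0 ≤ ψ x i) (hC : 0 ≤ CLip) (hΦ : ∀ x y, |Φ x - Φ y| ≤ CLip * ‖ψ x - ψ y‖)
    (hV : Measurable V) (hi : Integrable (fun ω => ‖ψ (constVec d M + V ω)‖) P) {x : E d}
    (hx : ‖x‖ ≤ M) : Integrable (fun ω => Φ (x + V ω)) P :=
  ((integrable_const |Φ 0|).add ((hi.add (integrable_const ‖ψ 0‖)).const_mul CLip)).mono'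
    ((measurable_of_abs_sub_le hψ hC hΦ).comp (hV.const_add x)).aestronglyMeasurable
    (ae_of_all _ fun ω => abs_add_le_of_increasing hmono h0 hC hΦ hx (V ω))

/-- The Cauchy–Schwarz inequality against an indicator function. -/
lemma setIntegral_le_sqrt_mul_sqrt {X : Ω → ℝ} (hX : AEStronglyMeasurable X P)
    (hX0 : ∀ ω, 0 ≤ X ω) (hX2 : Integrable (fun ω => X ω ^ 2) P) {S : Set Ω}
    (hS : MeasurableSet S) :
    ∫ ω in S, X ω ∂P ≤ Real.sqrt (∫ ω, X ω ^ 2 ∂P) * Real.sqrt (P.real S) := by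
  have h2 : (2 : ENNReal) = ENNReal.ofReal 2 := by simp
  have h := integral_mul_le_Lp_mul_Lq_of_nonneg (μ := P) Real.HolderConjugate.two_two
    (f := X) (g := S.indicator fun _ => (1 : ℝ)) (ae_of_all _ hX0)
    (ae_of_all _ fun ω => Set.indicator_nonneg (fun _ _ => zero_le_one) ω)
    (by rw [← h2]; exact (memLp_two_iff_integrable_sq hX).2 hX2)
    (by rw [← h2]; exact memLp_indicator_const 2 hS 1 (Or.inr (measure_ne_top _ _)))
  have e1 : ∀ ω, X ω * S.indicator (fun _ => (1 : ℝ)) ω = S.indicator X ω := fun ω => by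
    by_cases h : ω ∈ S <;> simp [h]
  have e2 : ∀ ω, S.indicator (fun _ => (1 : ℝ)) ω ^ 2 = S.indicator (fun _ => (1 : ℝ)) ω :=
    fun ω => by by_cases h : ω ∈ S <;> simp [h]
  simp only [e1, Real.rpow_two, e2, ← Real.sqrt_eq_rpow] at h
  rwa [integral_indicator hS, integral_indicator_const _ hS, smul_eq_mul, mul_one] at h

/-- Cutting off `Φ` outside the ball of radius `M + T` changes the smoothed function on the ball of
radius `M` only through the event `T < ‖V‖`. -/
lemma abs_integral_sub_integral_indicator_le (hψ : Measurable ψ) (hmono : Increasing ψ)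
    (h0 : ∀ x i, 0 ≤ ψ x i) (hC : 0 ≤ CLip) (hΦ : ∀ x y, |Φ x - Φ y| ≤ CLip * ‖ψ x - ψ y‖)
    (hV : Measurable V) (hi2 : Integrable (fun ω => ‖ψ (constVec d M + V ω)‖ ^ 2) P) {x : E d}
    (hx : ‖x‖ ≤ M) (T : ℝ) :
    |∫ ω, Φ (x + V ω) ∂P -
        ∫ ω, (Metric.closedBall (0 : E d) (M + T)).indicator Φ (x + V ω) ∂P| ≤
      (CLip * (Real.sqrt (∫ ω, ‖ψ (constVec d M + V ω)‖ ^ 2 ∂P) + ‖ψ 0‖) + |Φ 0|) *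
        Real.sqrt (P.real {ω | T < ‖V ω‖}) := by
  have hXm : Measurable fun ω => ‖ψ (constVec d M + V ω)‖ := (hψ.comp (hV.const_add _)).norm
  have hi : Integrable (fun ω => ‖ψ (constVec d M + V ω)‖) P :=
    ((memLp_two_iff_integrable_sq hXm.aestronglyMeasurable).2 hi2).integrable one_le_two
  have hΦm := measurable_of_abs_sub_le hψ hC hΦ
  have hΦi := integrable_add_of_increasing hψ hmono h0 hC hΦ hV hi hx
  have hS : MeasurableSet {ω | T < ‖V ω‖} := measurableSet_lt measurable_const hV.norm
  set S := {ω | T < ‖V ω‖} with hSdef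
  have hind : Integrable
      (fun ω => (Metric.closedBall (0 : E d) (M + T)).indicator Φ (x + V ω)) P :=
    hΦi.mono ((hΦm.indicator measurableSet_closedBall).comp
      (hV.const_add x)).aestronglyMeasurable (ae_of_all _ fun ω => norm_indicator_le_norm_self _ _)
  have hbd : Integrable (fun ω => |Φ 0| + CLip * (‖ψ (constVec d M + V ω)‖ + ‖ψ 0‖)) P :=
    (integrable_const |Φ 0|).add ((hi.add (integrable_const ‖ψ 0‖)).const_mul CLip)
  rw [← integral_sub hΦi hind]
  have h1 : |∫ ω, (Φ (x + V ω) -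
      (Metric.closedBall (0 : E d) (M + T)).indicator Φ (x + V ω)) ∂P| ≤
      ∫ ω in S, (|Φ 0| + CLip * (‖ψ (constVec d M + V ω)‖ + ‖ψ 0‖)) ∂P := by
    rw [← integral_indicator hS]
    refine abs_integral_le_integral_abs.trans (integral_mono (hΦi.sub hind).abs
      (hbd.indicator hS) fun ω => ?_)
    have hb := abs_add_le_of_increasing hmono h0 hC hΦ hx (V ω)
    have hnn := (abs_nonneg _).trans hb
    by_cases hω : x + V ω ∈ Metric.closedBall (0 : E d) (M + T)
    · simp only [Set.indicator_of_mem hω, sub_self, abs_zero]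
      exact Set.indicator_apply_nonneg fun _ => hnn
    · have hωS : ω ∈ S := by
        rw [mem_closedBall_zero_iff, not_le] at hω
        have := norm_add_le x (V ω)
        simp only [hSdef, Set.mem_ofPred_eq]
        linarith
      simp only [Set.indicator_of_notMem hω, Set.indicator_of_mem hωS, sub_zero]
      exact hb
  refine h1.trans ?_
  have h2 := setIntegral_le_sqrt_mul_sqrt hXm.aestronglyMeasurable (fun ω => norm_nonneg _) hi2 hS
  have hP0 : 0 ≤ P.real S := measureReal_nonneg
  have hP1 : P.real S ≤ 1 := measureReal_le_one
  have h3 : P.real S ≤ Real.sqrt (P.real S) := Real.le_sqrt_of_sq_le (by nlinarith)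
  have e : ∫ ω in S, (|Φ 0| + CLip * (‖ψ (constVec d M + V ω)‖ + ‖ψ 0‖)) ∂P =
      (|Φ 0| + CLip * ‖ψ 0‖) * P.real S + CLip * ∫ ω in S, ‖ψ (constVec d M + V ω)‖ ∂P := by
    have : ∀ ω, |Φ 0| + CLip * (‖ψ (constVec d M + V ω)‖ + ‖ψ 0‖) =
        (|Φ 0| + CLip * ‖ψ 0‖) + CLip * ‖ψ (constVec d M + V ω)‖ := fun ω => by ring
    simp only [this]
    rw [integral_add (integrable_const _) (hi.integrableOn.const_mul _), integral_const_mul,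
      setIntegral_const, smul_eq_mul, mul_comm (P.real S)]
  rw [e]
  have h4 := mul_le_mul_of_nonneg_left h2 hC
  have h5 : (|Φ 0| + CLip * ‖ψ 0‖) * P.real S ≤ (|Φ 0| + CLip * ‖ψ 0‖) * Real.sqrt (P.real S) :=
    mul_le_mul_of_nonneg_left h3 (by positivity)
  linarith

end Truncation

/-! ### The smoothed function as a superposition of waves -/

/-- The amplitude at frequency `ξ` of the function `x ↦ ∫ F (x + v) dm`. -/
noncomputable def waveAmplitude {d : ℕ} (m : Measure (E d)) (F : E d → ℝ) (ξ : E d) : ℂ :=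
  ((2 * Real.pi : ℂ) ^ d)⁻¹ * charFun m ξ *
    ∫ y, (F y : ℂ) * Complex.exp (-(inner ℝ y ξ * Complex.I))

section Wave

variable {d : ℕ} {m : Measure (E d)} {F : E d → ℝ} {C : ℝ}

lemma norm_waveAmplitude_le (hm : ∀ ξ, ‖charFun m ξ‖ ≤ Real.exp (-C * ‖ξ‖ ^ 2)) (ξ : E d) :
    ‖waveAmplitude m F ξ‖ ≤
      ((2 * Real.pi) ^ d)⁻¹ * (∫ y, |F y|) * Real.exp (-C * ‖ξ‖ ^ 2) := by
  have h1 : ‖∫ y, (F y : ℂ) * Complex.exp (-(inner ℝ y ξ * Complex.I))‖ ≤ ∫ y, |F y| := by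
    refine (norm_integral_le_integral_norm _).trans (le_of_eq ?_)
    simp only [norm_mul, norm_cexp_neg_inner_mul_I, mul_one, Complex.norm_real, Real.norm_eq_abs]
  have h2 : ‖((2 * Real.pi : ℂ) ^ d)⁻¹‖ = ((2 * Real.pi) ^ d)⁻¹ := by
    rw [norm_inv, norm_pow, norm_mul, Complex.norm_real, Real.norm_of_nonneg Real.pi_pos.le]
    simp
  have := Real.pi_pos
  rw [waveAmplitude, norm_mul, norm_mul, h2]
  calc ((2 * Real.pi) ^ d)⁻¹ * ‖charFun m ξ‖ *
        ‖∫ y, (F y : ℂ) * Complex.exp (-(inner ℝ y ξ * Complex.I))‖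
      ≤ ((2 * Real.pi) ^ d)⁻¹ * Real.exp (-C * ‖ξ‖ ^ 2) * ∫ y, |F y| := by
        gcongr
        exact hm ξ
    _ = _ := by ring

variable [IsFiniteMeasure m]

lemma measurable_waveAmplitude (hF : Integrable F) : Measurable (waveAmplitude m F) := by
  refine (measurable_const.mul measurable_charFun).mul (Continuous.measurable ?_)
  refine continuous_of_dominated (bound := fun y => ‖F y‖) (fun ξ => ?_)
    (fun ξ => ae_of_all _ fun y => ?_) hF.norm (ae_of_all _ fun y => by fun_prop)
  · exact hF.ofReal.aestronglyMeasurable.mul (by fun_prop)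
  · rw [norm_mul, norm_cexp_neg_inner_mul_I, mul_one, Complex.norm_real]

lemma integrable_waveAmplitude (hC : 0 < C)
    (hm : ∀ ξ, ‖charFun m ξ‖ ≤ Real.exp (-C * ‖ξ‖ ^ 2)) (hF : Integrable F) :
    Integrable (waveAmplitude m F) :=
  ((integrable_gaussian (E d) hC).const_mul _).mono'
    (measurable_waveAmplitude hF).aestronglyMeasurable (ae_of_all _ (norm_waveAmplitude_le hm))

/-- `integral_translate_eq` for a law of Gaussian-dominated characteristic function. -/
lemma integral_translate_eq_re (hC : 0 < C)
    (hm : ∀ ξ, ‖charFun m ξ‖ ≤ Real.exp (-C * ‖ξ‖ ^ 2)) (hF : Measurable F) {c r : ℝ}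
    (hc : ∀ y, |F y| ≤ c) (hr : ∀ y, r < ‖y‖ → F y = 0) (hFi : Integrable F) (x : E d) :
    ∫ v, F (x + v) ∂m =
      (∫ ξ, waveAmplitude m F ξ * Complex.exp (inner ℝ x ξ * Complex.I)).re := by
  have hmi : Integrable (charFun m) := (integrable_gaussian (E d) hC).mono'
    measurable_charFun.aestronglyMeasurable (ae_of_all _ hm)
  have h := congrArg Complex.re (integral_translate_eq m hmi hF hc hr hFi x)
  rw [Complex.ofReal_re, finrank_euclideanSpace_fin] at h
  exact h

lemma continuous_integral_waveAmplitude (hC : 0 < C)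
    (hm : ∀ ξ, ‖charFun m ξ‖ ≤ Real.exp (-C * ‖ξ‖ ^ 2)) (hF : Integrable F) :
    Continuous fun x : E d =>
      (∫ ξ, waveAmplitude m F ξ * Complex.exp (inner ℝ x ξ * Complex.I)).re := by
  have hi := integrable_waveAmplitude hC hm hF
  refine Complex.continuous_re.comp (continuous_of_dominated
    (bound := fun ξ => ‖waveAmplitude m F ξ‖) (fun x => ?_)
    (fun x => ae_of_all _ fun ξ => ?_) hi.norm (ae_of_all _ fun ξ => by fun_prop))
  · exact hi.aestronglyMeasurable.mul (by fun_prop)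
  · rw [norm_mul, norm_cexp_inner_mul_I, mul_one]

end Wave

/-! ### The approximation theorem -/

lemma exists_mul_sqrt_measureReal_lt {Ω F : Type*} [MeasurableSpace Ω] [NormedAddCommGroup F]
    [MeasurableSpace F] [OpensMeasurableSpace F] {P : Measure Ω} [IsFiniteMeasure P] {V : Ω → F}
    (hV : Measurable V) (c : ℝ) {ε : ℝ} (hε : 0 < ε) :
    ∃ n : ℕ, c * Real.sqrt (P.real {ω | (n : ℝ) < ‖V ω‖}) < ε := by
  have h1 : Filter.Tendsto (fun n : ℕ => P {ω | (n : ℝ) < ‖V ω‖}) Filter.atTop (nhds 0) := by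
    have h := tendsto_measure_iInter_atTop (μ := P) (s := fun n : ℕ => {ω | (n : ℝ) < ‖V ω‖})
      (fun n => (measurableSet_lt measurable_const hV.norm).nullMeasurableSet)
      (fun n k hnk ω (hω : (k : ℝ) < ‖V ω‖) => lt_of_le_of_lt (Nat.cast_le.2 hnk) hω)
      ⟨0, measure_ne_top _ _⟩
    have he : ⋂ n : ℕ, {ω | (n : ℝ) < ‖V ω‖} = ∅ := by
      refine Set.eq_empty_of_forall_notMem fun ω hω => ?_
      obtain ⟨n, hn⟩ := exists_nat_gt ‖V ω‖
      exact lt_asymm hn (Set.mem_iInter.1 hω n)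
    rwa [he, measure_empty] at h
  have h2 : Filter.Tendsto (fun n : ℕ => c * Real.sqrt (P.real {ω | (n : ℝ) < ‖V ω‖}))
      Filter.atTop (nhds 0) := by
    have h3 := (ENNReal.tendsto_toReal ENNReal.zero_ne_top).comp h1
    simpa [Measure.real, Function.comp_def] using (h3.sqrt.const_mul c)
  exact (h2.eventually_lt_const hε).exists

end RandomNN

open RandomNN

theorem mainTheorem10 (pib : ℝ → ℝ) (hpib : Measurable pib)
    (hdecay : RandomNN.AtMostPolynomialDecay pib) :
    ∃ k : ℕ, ∀ ν C M : ℝ, 1 < ν → 0 < C → 1 / (8 * Real.pi ^ 2) < C ^ 2 → 0 < M →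
    ∃ Capp : ℝ, 0 < Capp ∧
    ∀ (d N : ℕ), 0 < d → 0 < N →
    ∀ (Ω : Type*) [MeasurableSpace Ω] (P : Measure Ω) [IsProbabilityMeasure P]
      (A : Fin N → Ω → RandomNN.E d) (B : Fin N → Ω → ℝ),
    RandomNN.IsHiddenWeights P ν pib A B →
    ∀ (CLip : ℝ), 0 < CLip →
    ∀ (ψ : RandomNN.E d → RandomNN.E d), Measurable ψ → RandomNN.Increasing ψ →
      (∀ x i, 0 ≤ ψ x i) →
    ∀ (Φ : RandomNN.E d → ℝ), (∀ x y, |Φ x - Φ y| ≤ CLip * ‖ψ x - ψ y‖) →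
    ∀ (V : Ω → RandomNN.E d), Measurable V →
      (∀ ξ, ‖charFun (P.map V) ξ‖ ≤ Real.exp (-C * ‖ξ‖ ^ 2)) →
      Integrable (fun ω => ‖ψ (RandomNN.constVec d M + V ω)‖ ^ 2) P →
    ∀ (H : RandomNN.E d → ℝ), (∀ x, H x = ∫ ω, Φ (x + V ω) ∂P) →
    ∀ R : ℝ, 0 < R →
    ∃ W : Ω → RandomNN.E N, Measurable[RandomNN.sigmaAB A B] W ∧
      Measurable (fun ω => RandomNN.supError M H (fun i => A i ω) (fun i => B i ω) (W ω)) ∧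
      ∫⁻ ω, RandomNN.supError M H (fun i => A i ω) (fun i => B i ω) (W ω) ∂P ≤
        ENNReal.ofReal
          (Capp * (∫ x in Metric.closedBall (0 : RandomNN.E d) (M + R), |Φ x|)
              * (ν + d) ^ (k + 3) / Real.sqrt N
            + (CLip * (Real.sqrt (∫ ω, ‖ψ (RandomNN.constVec d M + V ω)‖ ^ 2 ∂P) + ‖ψ 0‖) + |Φ 0|)
              * Real.sqrt (P.real {ω | R < ‖V ω‖})) := by
  -- The second moment of the features is linear in `ν + d`, and `√(ν + d) ≤ (ν + d) ^ 3`, so that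
  -- no further power of the dimension is needed.
  refine ⟨0, fun ν C M hν hC hC2 hM => ?_⟩
  have hν0 : 0 < ν := by linarith
  obtain ⟨K, hK, hmom⟩ := exists_lintegral_importanceWeight_le hpib hdecay hν0 hC hC2 hM.le
  refine ⟨4 * (M + 1) * Real.sqrt K, by positivity, ?_⟩
  intro d N hd hN Ω _ P _ A B hw CLip hCL ψ hψ hmono h0 Φ hΦ V hV hchar hi2 H hH R hR
  -- The hidden weights exist and have these laws, so the laws are probability measures.
  have hpA : IsProbabilityMeasure (studentT d ν) :=
    hw.law_A ⟨0, hN⟩ ▸ Measure.isProbabilityMeasure_map (hw.measurable_A _).aemeasurable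
  have hpB : IsProbabilityMeasure (volume.withDensity fun b => ENNReal.ofReal (pib b)) :=
    hw.law_B ⟨0, hN⟩ ▸ Measure.isProbabilityMeasure_map (hw.measurable_B _).aemeasurable
  have hpV : IsProbabilityMeasure (P.map V) := Measure.isProbabilityMeasure_map hV.aemeasurable
  have hpos : ∀ b, 0 < pib b := by
    obtain ⟨p, hp⟩ := hdecay
    exact fun b => pos_of_mul_pos_right (zero_lt_one.trans_le (hp b).2) (hp b).1.le
  have hΦm := measurable_of_abs_sub_le hψ hCL.le hΦ
  set F : ℝ → E d → ℝ := fun T => (Metric.closedBall (0 : E d) (M + T)).indicator Φ with hF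
  have hFm : ∀ T, Measurable (F T) := fun T => hΦm.indicator measurableSet_closedBall
  have hFc : ∀ T, ∃ c, ∀ y, |F T y| ≤ c := fun T => by
    obtain ⟨c, hc0, hc⟩ := exists_abs_le_of_increasing hmono h0 hCL.le hΦ (M + T)
    refine ⟨c, fun y => ?_⟩
    by_cases hy : y ∈ Metric.closedBall (0 : E d) (M + T)
    · simpa [hF, Set.indicator_of_mem hy] using hc y (mem_closedBall_zero_iff.1 hy)
    · simpa [hF, Set.indicator_of_notMem hy] using hc0
  have hFr : ∀ T y, M + T < ‖y‖ → F T y = 0 := fun T y hy =>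
    Set.indicator_of_notMem (fun h => (mem_closedBall_zero_iff.1 h).not_gt hy) _
  have hFi : ∀ T, Integrable (F T) := fun T => by
    obtain ⟨c, hc⟩ := hFc T
    rw [hF, integrable_indicator_iff measurableSet_closedBall]
    refine Measure.integrableOn_of_bounded (M := c) measure_closedBall_lt_top.ne
      hΦm.aestronglyMeasurable ?_
    filter_upwards [ae_restrict_mem measurableSet_closedBall] with y hy
    simpa [hF, Set.indicator_of_mem hy] using hc y
  set HT : ℝ → E d → ℝ := fun T x =>
    (∫ ξ, waveAmplitude (P.map V) (F T) ξ * Complex.exp (inner ℝ x ξ * Complex.I)).re with hHT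
  set Cmom := CLip * (Real.sqrt (∫ ω, ‖ψ (constVec d M + V ω)‖ ^ 2 ∂P) + ‖ψ 0‖) + |Φ 0|
    with hCmom
  have hCmom0 : 0 ≤ Cmom := by positivity
  have hdiff : ∀ T x, ‖x‖ ≤ M → |H x - HT T x| ≤ Cmom * Real.sqrt (P.real {ω | T < ‖V ω‖}) := by
    intro T x hx
    obtain ⟨c, hc⟩ := hFc T
    have h1 := integral_translate_eq_re hC hchar (hFm T) hc (hFr T) (hFi T) x
    rw [integral_map (f := fun v => F T (x + v)) hV.aemeasurable
      ((hFm T).comp (measurable_const_add x)).aestronglyMeasurable] at h1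
    rw [hH x]
    simp only [hHT]
    rw [← h1]
    exact abs_integral_sub_integral_indicator_le hψ hmono h0 hCL.le hΦ hV hi2 hx T
  have hHTc : ∀ T, Continuous (HT T) := fun T =>
    continuous_integral_waveAmplitude hC hchar (hFi T)
  -- `H` is a uniform limit on the ball of the smoothed cut-off functions.
  have hHc : ContinuousOn H (Metric.closedBall 0 M) := by
    refine continuousOn_of_uniform_approx_of_continuousOn fun u hu => ?_
    obtain ⟨ε, hε, hεu⟩ := Metric.mem_uniformity_dist.1 hu
    obtain ⟨n, hn⟩ := exists_mul_sqrt_measureReal_lt (P := P) hV Cmom hε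
    refine ⟨HT n, (hHTc n).continuousOn, fun y hy => hεu ?_⟩
    rw [Real.dist_eq]
    exact (hdiff n y (mem_closedBall_zero_iff.1 hy)).trans_lt hn
  set g := waveAmplitude (P.map V) (F R) with hg
  have hgm : Measurable g := measurable_waveAmplitude (hFi R)
  set I := ∫ y, |F R y| with hI
  have hIΦ : I = ∫ x in Metric.closedBall (0 : E d) (M + R), |Φ x| := by
    rw [hI, ← integral_indicator measurableSet_closedBall]
    refine integral_congr_ae (ae_of_all _ fun y => ?_)
    by_cases hy : y ∈ Metric.closedBall (0 : E d) (M + R)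
    · simp only [hF, Set.indicator_of_mem hy]
    · simp only [hF, Set.indicator_of_notMem hy, abs_zero]
  have hI0 : 0 ≤ I := integral_nonneg fun _ => abs_nonneg _
  have hL := hmom d g I hgm (norm_waveAmplitude_le hchar)
  set c := importanceWeight ν M pib g with hc
  have hcm : Measurable c := measurable_importanceWeight hpib hgm
  have hmean : ∀ x : E d, ‖x‖ ≤ M →
      ∫ z, c z * relu (inner ℝ z.1 x + z.2) ∂((studentT d ν).prod
        (volume.withDensity fun b => ENNReal.ofReal (pib b))) = HT R x := fun x hx =>
    integral_importanceWeight_mul_relu hpib hpos hν0 (integrable_waveAmplitude hC hchar (hFi R)) hx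
      (integrable_mul_relu hcm measurable_snd measurable_fst hL hx)
  have : Nonempty (Metric.closedBall (0 : E d) M) := ⟨⟨0, by simpa using hM.le⟩⟩
  set x : ℕ → E d := fun n => TopologicalSpace.denseSeq (Metric.closedBall (0 : E d) M) n with hx
  have hxM : ∀ n, ‖x n‖ ≤ M := fun n =>
    mem_closedBall_zero_iff.1 (TopologicalSpace.denseSeq (Metric.closedBall (0 : E d) M) n).2
  set G : (Fin N → E d) × (Fin N → ℝ) → E N := fun p => WithLp.toLp 2 fun i =>
    c (p.1 i, p.2 i) / N with hG
  have hGm : Measurable G := by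
    refine (MeasurableEquiv.toLp 2 (Fin N → ℝ)).measurable.comp (measurable_pi_lambda _ fun i => ?_)
    exact (hcm.comp (((measurable_pi_apply i).comp measurable_fst).prodMk
      ((measurable_pi_apply i).comp measurable_snd))).div_const _
  set W : Ω → E N := fun ω => G (fun i => A i ω, fun i => B i ω) with hW
  have hsup : ∀ ω, supError M H (fun i => A i ω) (fun i => B i ω) (W ω) =
      ⨆ n, ENNReal.ofReal |network (fun i => A i ω) (fun i => B i ω) (W ω) (x n) - H (x n)| :=
    fun ω => iSup_closedBall_eq_iSup_denseSeq ((continuous_network _ _ _).continuousOn.sub hHc)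
  have hWm : Measurable W := hGm.comp
    ((measurable_pi_lambda _ hw.measurable_A).prodMk (measurable_pi_lambda _ hw.measurable_B))
  have hnet : ∀ y, Measurable fun ω => network (fun i => A i ω) (fun i => B i ω) (W ω) y := by
    intro y
    have hWi : ∀ i, Measurable fun ω => W ω i := fun i =>
      (measurable_pi_apply i).comp ((MeasurableEquiv.toLp 2 (Fin N → ℝ)).symm.measurable.comp hWm)
    exact Finset.measurable_sum _ fun i _ => (hWi i).mul
      ((((hw.measurable_A i).inner measurable_const).add (hw.measurable_B i)).max measurable_const)
  refine ⟨W, hGm.comp (comap_measurable _), ?_, ?_⟩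
  · simp only [hsup]
    exact Measurable.iSup fun n => ((hnet (x n)).sub_const _).abs.ennreal_ofReal
  set δ := Cmom * Real.sqrt (P.real {ω | R < ‖V ω‖}) with hδ
  have hδ0 : 0 ≤ δ := by positivity
  have hKd : 0 ≤ K * I ^ 2 * (ν + d) := by positivity
  have hstoch := lintegral_iSup_network_sub_le hN hw hcm hKd hM.le hL x hxM
  have hle : ∀ ω, supError M H (fun i => A i ω) (fun i => B i ω) (W ω) ≤
      (⨆ n, ENNReal.ofReal |network (fun i => A i ω) (fun i => B i ω) (W ω) (x n) -
        ∫ z, c z * relu (inner ℝ z.1 (x n) + z.2) ∂((studentT d ν).prod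
          (volume.withDensity fun b => ENNReal.ofReal (pib b)))|) + ENNReal.ofReal δ := by
    intro ω
    rw [hsup]
    refine iSup_le fun n => ?_
    refine le_trans ?_ (add_le_add_left (le_iSup (fun n => ENNReal.ofReal
      |network (fun i => A i ω) (fun i => B i ω) (W ω) (x n) -
        ∫ z, c z * relu (inner ℝ z.1 (x n) + z.2) ∂((studentT d ν).prod
          (volume.withDensity fun b => ENNReal.ofReal (pib b)))|) n) _)
    rw [← ENNReal.ofReal_add (abs_nonneg _) hδ0, hmean _ (hxM n)]
    refine ENNReal.ofReal_le_ofReal ?_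
    have h1 := hdiff R (x n) (hxM n)
    rw [abs_sub_comm] at h1
    exact (abs_sub_le _ (HT R (x n)) _).trans (add_le_add le_rfl h1)
  refine (lintegral_mono hle).trans ?_
  rw [lintegral_add_right _ measurable_const, lintegral_const, measure_univ, mul_one]
  refine (add_le_add_left hstoch _).trans ?_
  rw [← ENNReal.ofReal_add (by positivity) hδ0]
  refine ENNReal.ofReal_le_ofReal (add_le_add_left ?_ δ)
  rw [← hIΦ]
  have h1 : (1 : ℝ) ≤ ν + d := by linarith [(Nat.cast_nonneg d : (0 : ℝ) ≤ d)]
  have h2 : Real.sqrt (K * I ^ 2 * (ν + d)) = Real.sqrt K * I * Real.sqrt (ν + d) := by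
    rw [Real.sqrt_mul (by positivity), Real.sqrt_mul hK.le, Real.sqrt_sq hI0]
  have h3 : Real.sqrt (ν + d) ≤ (ν + d) ^ (0 + 3) := by
    refine Real.sqrt_le_iff.2 ⟨by positivity, ?_⟩
    rw [← pow_mul]
    exact le_self_pow₀ h1 (by norm_num)
  rw [h2]
  calc 4 * (M + 1) * (Real.sqrt K * I * Real.sqrt (ν + d)) / Real.sqrt N
      ≤ 4 * (M + 1) * (Real.sqrt K * I * (ν + d) ^ (0 + 3)) / Real.sqrt N := by gcongr
    _ = 4 * (M + 1) * Real.sqrt K * I * (ν + d) ^ (0 + 3) / Real.sqrt N := by ring
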